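/- Conventions. Let $X$ be a set with at least two points. A quasi-metric on $X$ is a function $\rho:X\times X\to[0,\infty)$ such that $\rho(x,y)=0$ if and only if $x=y$, and such that $\rho(y,x)\le K_0\,\rho(x,y)$ and $\rho(x,y)\le K_1\max\{\rho(x,z),\rho(z,y)\}$ for all $x,y,z\in X$ and some constants $K_0,K_1\in(0,\infty)$. Put $$C_\rho:=\sup\left\{\frac{\rho(x,y)}{\max\{\rho(x,z),\rho(z,y)\}}:\ x,y,z\in X\text{ not all equal}\right\}\in[1,\infty)$$ and $B_\rho(x,r):=\{y\in X:\rho(x,y)<r\}$. The triple $(X,\rho,\mu)$ is a quasi-metric measure space if $\mu$ is a nonnegative Borel measure on $X$ (with the topology generated by $\rho$) such that every ball $B_\rho(x,r)$, $x\in X$, $r\in(0,\infty)$, is $\mu$-measurable and satisfies $0<\mu(B_\rho(x,r))<\infty$. For a ball $B_0=B_\rho(z_0,R_0)$ (with specified centre and radius) and $\sigma\ge1$ write $\sigma B_0:=B_\rho(z_0,\sigma R_0)$. Given $Q,b\in(0,\infty)$, $\mu$ satisfies the $V(\sigma B_0,Q,b)$ condition if $\mu(B_\rho(x,r))\ge b\,r^Q$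 for all $x\in X$ and $r\in(0,\sigma R_0]$ with $B_\rho(x,r)\subset\sigma B_0$. Let $A\subset X$ be a ball, and $s,p\in(0,\infty)$. A $\mu$-measurable function $g:A\to[0,\infty]$ is an $s$-gradient of a $\mu$-measurable function $u:A\to\mathbb R$, written $g\in\mathcal D^s_\rho(u)$, if there is a set $E$ with $\mu(E)=0$ such that $|u(x)-u(y)|\le\rho(x,y)^s[g(x)+g(y)]$ for all $x,y\in A\setminus E$. The space $\dot M^{s,p}(A,\rho,\mu)$ consists of all $\mu$-measurable $u:A\to\mathbb R$ with $\inf_{g\in\mathcal D^s_\rho(u)}\|g\|_{L^p(A)}<\infty$, where $\|g\|_{L^p(A)}:=(\int_A g^p\,d\mu)^{1/p}$ and $\inf\emptyset:=\infty$. We write $-\!\!\!\!\!\!\int_A f\,d\mu:=\mu(A)^{-1}\int_A f\,d\mu$ and $u_A:=-\!\!\!\!\!\!\int_A u\,d\mu$. Theorem. Let $(X,\rho,\mu)$ be a quasi-metric measure space, let $s,p\in(0,\infty)$ and $\sigma\in[C_\rho,\infty)$, and let $B_0$ be a $\rho$-ball of radius $R_0\in(0,\infty)$. Assume that $\mu$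 satisfies the $V(\sigma B_0,Q,b)$ condition for some $Q,b\in(0,\infty)$. Then there exist positive constants $C,C_1,C_2$, depending only on $\rho,s,p,Q$ and $\sigma$ (in particular not on $\mu$, $B_0$, $b$, $u$ or $g$), such that, for any $u\in\dot M^{s,p}(\sigma B_0,\rho,\mu)$ and any $s$-gradient $g$ of $u$ on $\sigma B_0$, the following hold. (a) If $p<Q/s$, then $u\in L^{p^*}(B_0)$, where $p^*:=Qp/(Q-sp)$, and $$\left(-\!\!\!\!\!\!\int_{B_0}|u|^{p^*}d\mu\right)^{1/p^*}\le C\left[\frac{\mu(\sigma B_0)}{bR_0^Q}\right]^{1/p}R_0^s\left(-\!\!\!\!\!\!\int_{\sigma B_0}g^p\,d\mu\right)^{1/p}+C\left(-\!\!\!\!\!\!\int_{\sigma B_0}|u|^p\,d\mu\right)^{1/p}$$ and $$\inf_{\gamma\in\mathbb R}\left(-\!\!\!\!\!\!\int_{B_0}|u-\gamma|^{p^*}d\mu\right)^{1/p^*}\le C\left[\frac{\mu(\sigma B_0)}{bR_0^Q}\right]^{1/p}R_0^s\left(-\!\!\!\!\!\!\int_{\sigma B_0}g^p\,d\mu\right)^{1/p}.$$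 (b) If $p=Q/s$ and $\|g\|_{L^{Q/s}(\sigma B_0)}>0$, then $u\in L^1(B_0)$ and $$-\!\!\!\!\!\!\int_{B_0}\exp\left(C_1b^{s/Q}\frac{|u-u_{B_0}|}{\|g\|_{L^{Q/s}(\sigma B_0)}}\right)d\mu\le C_2,$$ where the quotient is read as $0$ if $\|g\|_{L^{Q/s}(\sigma B_0)}=\infty$. (c) If $p>Q/s$, then $u\in L^1(B_0)$ and $$\|u-u_{B_0}\|_{L^\infty(B_0)}\le C\left[\frac{\mu(\sigma B_0)}{bR_0^Q}\right]^{1/p}R_0^s\left(-\!\!\!\!\!\!\int_{\sigma B_0}g^p\,d\mu\right)^{1/p}.$$ Moreover, $u$ has a representative on $B_0$ (a function $v$ with $v=u$ $\mu$-almost everywhere in $B_0$) which is Hölder continuous of order $s-Q/p$ on $B_0$ with respect to $\rho$ and satisfies $$|v(x)-v(y)|\le C\,b^{-1/p}\,\rho(x,y)^{s-Q/p}\left(\int_{\sigma B_0}g^p\,d\mu\right)^{1/p}\quad\text{for all }x,y\in B_0.$$ -/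

import Mathlib

open MeasureTheory Set
open scoped ENNReal

noncomputable section

namespace HajlaszEmbedding

/-- `ρ` is a quasi-metric on `X`: nonnegative, nondegenerate, quasi-symmetric, and satisfying the
quasi-subadditivity condition `ρ x y ≤ K₁ * max (ρ x z) (ρ z y)`. -/
structure IsQuasiMetric {X : Type*} (ρ : X → X → ℝ) : Prop where
  nonneg : ∀ x y, 0 ≤ ρ x y
  eq_zero_iff : ∀ x y, ρ x y = 0 ↔ x = y
  quasi_symm : ∃ K₀ : ℝ, 0 < K₀ ∧ ∀ x y, ρ y x ≤ K₀ * ρ x y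
  quasi_subadd : ∃ K₁ : ℝ, 0 < K₁ ∧ ∀ x y z, ρ x y ≤ K₁ * max (ρ x z) (ρ z y)

/-- The constant `C_ρ`: the supremum of `ρ x y / max (ρ x z) (ρ z y)` over all points `x, y, z`
which are not all equal. -/
def quasiConst {X : Type*} (ρ : X → X → ℝ) : ℝ :=
  sSup {t : ℝ | ∃ x y z : X, ¬ (x = y ∧ y = z) ∧ t = ρ x y / max (ρ x z) (ρ z y)}

/-- The ball `B_ρ(x, r) = {y : ρ x y < r}`. -/
def qball {X : Type*} (ρ : X → X → ℝ) (x : X) (r : ℝ) : Set X := {y | ρ x y < r}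

/-- The topology generated by `ρ`: a set is open if with each of its points it contains a
`ρ`-ball centred at that point (`ρ`-balls themselves need not be open). -/
@[reducible] def qtopology {X : Type*} (ρ : X → X → ℝ) : TopologicalSpace X where
  IsOpen O := ∀ x ∈ O, ∃ r : ℝ, 0 < r ∧ qball ρ x r ⊆ O
  isOpen_univ := fun _ _ => ⟨1, one_pos, subset_univ _⟩
  isOpen_inter := by
    rintro O O' h h' x ⟨hx, hx'⟩
    obtain ⟨r, hr, hO⟩ := h x hx
    obtain ⟨r', hr', hO'⟩ := h' x hx'
    refine ⟨min r r', lt_min hr hr', fun y (hy : ρ x y < min r r') => ⟨hO ?_, hO' ?_⟩⟩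
    · exact lt_of_lt_of_le hy (min_le_left _ _)
    · exact lt_of_lt_of_le hy (min_le_right _ _)
  isOpen_sUnion := by
    rintro S h x ⟨O, hO, hx⟩
    obtain ⟨r, hr, hsub⟩ := h O hO x hx
    exact ⟨r, hr, hsub.trans (subset_sUnion_of_mem hO)⟩

/-- The measure `μ` makes `(X, ρ)` a quasi-metric measure space: its domain contains the Borel sets
of `(X, ρ)`, and all `ρ`-balls are `μ`-measurable and have positive and finite measure. -/
structure IsQuasiMetricMeasure {X : Type*} (ρ : X → X → ℝ) [m : MeasurableSpace X]
    (μ : Measure X) : Prop where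
  borel_le : @borel X (qtopology ρ) ≤ m
  ball_measurable : ∀ (x : X) (r : ℝ), 0 < r → NullMeasurableSet (qball ρ x r) μ
  ball_pos : ∀ (x : X) (r : ℝ), 0 < r → 0 < μ (qball ρ x r)
  ball_lt_top : ∀ (x : X) (r : ℝ), 0 < r → μ (qball ρ x r) < ∞

/-- The `V(σ B₀, Q, b)` condition for the ball `B₀ = B_ρ(z₀, R₀)`, where `σ B₀ = B_ρ(z₀, σ R₀)`. -/
def VCondition {X : Type*} (ρ : X → X → ℝ) [MeasurableSpace X] (μ : Measure X)
    (z₀ : X) (R₀ σ Q b : ℝ) : Prop :=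
  ∀ (x : X) (r : ℝ), 0 < r → r ≤ σ * R₀ → qball ρ x r ⊆ qball ρ z₀ (σ * R₀) →
    ENNReal.ofReal (b * r ^ Q) ≤ μ (qball ρ x r)

/-- The (quasi-)norm `‖g‖_{L^p(A)} = (∫_A g ^ p dμ) ^ (1 / p)` of a function `g : A → [0, ∞]`. -/
def lpNormOn {X : Type*} [MeasurableSpace X] (μ : Measure X) (A : Set X) (p : ℝ)
    (g : X → ℝ≥0∞) : ℝ≥0∞ :=
  (∫⁻ x in A, g x ^ p ∂μ) ^ (1 / p)

/-- `g` is an `s`-gradient of `u` on the quasi-metric space `(A, ρ, μ)`, `A ⊆ X`. Only the values of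
`u` and `g` on `A` matter, and measurability is with respect to the completion of `μ` on `A`. -/
structure IsGradient {X : Type*} (ρ : X → X → ℝ) [MeasurableSpace X] (μ : Measure X)
    (A : Set X) (s : ℝ) (u : X → ℝ) (g : X → ℝ≥0∞) : Prop where
  aemeasurable : AEMeasurable g (μ.restrict A)
  le : ∃ E : Set X, μ E = 0 ∧ ∀ x ∈ A \ E, ∀ y ∈ A \ E,
    ENNReal.ofReal |u x - u y| ≤ ENNReal.ofReal (ρ x y ^ s) * (g x + g y)

/-- The semi-norm of the homogeneous Hajłasz–Sobolev space on `(A, ρ, μ)` (with `inf ∅ = ∞`). -/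
def hajlaszSeminorm {X : Type*} (ρ : X → X → ℝ) [MeasurableSpace X] (μ : Measure X)
    (A : Set X) (s p : ℝ) (u : X → ℝ) : ℝ≥0∞ :=
  ⨅ (g : X → ℝ≥0∞) (_ : IsGradient ρ μ A s u g), lpNormOn μ A p g

/-- Membership of `u` in the homogeneous Hajłasz–Sobolev space on `(A, ρ, μ)`. -/
structure MemHajlasz {X : Type*} (ρ : X → X → ℝ) [MeasurableSpace X] (μ : Measure X)
    (A : Set X) (s p : ℝ) (u : X → ℝ) : Prop where
  aemeasurable : AEMeasurable u (μ.restrict A)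
  seminorm_lt_top : hajlaszSeminorm ρ μ A s p u < ∞

/-- The quantity `[μ(σ B₀) / (b R₀^Q)]^{1/p} R₀^s (⨍_{σ B₀} g^p dμ)^{1/p}`, for
`B₀ = B_ρ(z₀, R₀)`. -/
def gradientTerm {X : Type*} (ρ : X → X → ℝ) [MeasurableSpace X] (μ : Measure X)
    (z₀ : X) (R₀ σ Q b s p : ℝ) (g : X → ℝ≥0∞) : ℝ≥0∞ :=
  (μ (qball ρ z₀ (σ * R₀)) / ENNReal.ofReal (b * R₀ ^ Q)) ^ (1 / p) * ENNReal.ofReal (R₀ ^ s) *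
    (⨍⁻ x in qball ρ z₀ (σ * R₀), g x ^ p ∂μ) ^ (1 / p)

/-- `v` is Hölder continuous of order `α` on `A` with respect to `ρ`. -/
def IsHolderOn {X : Type*} (ρ : X → X → ℝ) (A : Set X) (α : ℝ) (v : X → ℝ) : Prop :=
  ∃ K : ℝ, ∀ x ∈ A, ∀ y ∈ A, |v x - v y| ≤ K * ρ x y ^ α

/-- The Sobolev exponent `p^* = Q p / (Q - s p)`. -/
def sobolevExp (Q s p : ℝ) : ℝ := Q * p / (Q - s * p)

end HajlaszEmbedding

end

/-! Fix a gradient `g` with finite norm `G` on `σ B₀`, and put `τ = Q / p`, `M = G b ^ (-1/p)`. For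
`x ∈ B₀` and `r ≤ R₀` the ball `B(x, r)` lies in `σ B₀`, since `σ ≥ C_ρ`. The volume condition
therefore bounds the average of `g ^ p` over it by `(M r ^ (-τ)) ^ p`, and some point of the ball
satisfies `g ≤ M r ^ (-τ)`. This is the only way the measure enters the pointwise argument
(`exists_chainData`); no maximal function and no doubling is needed.

Choosing such good points in the balls `B(x, 2 ^ (-i) r)` and telescoping, the gradient inequality
bounds the i-th increment of `u` by a constant times `M (2 ^ (-i) r) ^ (s - τ)` (`ChainData.chain`).
For almost every `x` the chain can end at `x` itself: it suffices to reach a level `n` with `g x ≤ M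
(2 ^ (-n) r) ^ (-τ)`. With `r = R₀`, the first such `n` has `2 ^ (n τ)` comparable to at most `1 + g
x R₀ ^ τ / M`. The theorem is then read off a geometric sum.

If `s < τ`, the last term dominates and gives `M ^ (s/τ) (g x) ^ (1 - s/τ)`, whose power `p^*` is a
multiple of `g ^ p` (`subcritical`). If `s = τ`, the sum is `n + 1`, logarithmic in `g x`, so an
exponential of `|u - u z| / M` is bounded by `1 + (g R₀ ^ τ / M) ^ p` up to a factor (`critical`).
If `s > τ`, the series converges, and limits along good points define the Hölder representative
(`supercritical`). Averaging over `B₀` finishes each case. -/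

noncomputable section

namespace HajlaszEmbedding

/-! ### Telescoping along shrinking balls -/

/-- The pointwise data on which the telescoping argument runs: `S` is a set of good points of the
ball `B(z₀, σ R₀)`, `h` is a finite gradient of `u` on `S`, and every ball of radius `r ≤ R₀`
centred in `B(z₀, R₀)` has a good point at which `h` is at most `M r ^ (-τ)`. -/
structure ChainData {X : Type*} (ρ : X → X → ℝ) (K σ s τ M R₀ : ℝ) (z₀ : X) (S : Set X)
    (u h : X → ℝ) : Prop where
  nonneg : ∀ x y, 0 ≤ ρ x y
  self : ∀ x, ρ x x = 0
  pos_of_ne : ∀ x y, x ≠ y → 0 < ρ x y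
  symm : ∀ x y, ρ y x ≤ K * ρ x y
  tri : ∀ x y z, ρ x y ≤ σ * max (ρ x z) (ρ z y)
  one_le_K : 1 ≤ K
  one_le_σ : 1 ≤ σ
  s_pos : 0 < s
  τ_pos : 0 < τ
  M_nonneg : 0 ≤ M
  R_pos : 0 < R₀
  h_nonneg : ∀ x, 0 ≤ h x
  mem_ball : ∀ x ∈ S, ρ z₀ x < σ * R₀
  grad : ∀ x ∈ S, ∀ y ∈ S, |u x - u y| ≤ ρ x y ^ s * (h x + h y)
  exists_good : ∀ x, ρ z₀ x < R₀ → ∀ r, 0 < r → r ≤ R₀ → ∃ y ∈ S, ρ x y < r ∧ h y ≤ M * r ^ (-τ)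
  pos_or : 0 < M ∨ ∀ x ∈ S, h x = 0

/-- The constant of a single step of the telescoping argument. -/
def stepConst (K σ s τ : ℝ) : ℝ := 2 * (σ * K) ^ s * 2 ^ τ

lemma stepConst_pos {K σ s τ : ℝ} (hK : 1 ≤ K) (hσ : 1 ≤ σ) : 0 < stepConst K σ s τ := by
  have : 0 < σ * K := by positivity
  unfold stepConst; positivity

namespace ChainData

variable {X : Type*} {ρ : X → X → ℝ} {K σ s τ M R₀ : ℝ} {z₀ : X} {S : Set X} {u h : X → ℝ}

/-- Passing through `x`, the points `y` and `y'` are at distance at most `σ K r`. The bounds on `h`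
are taken at radius `r / 2` so that one of the points may come from the next dyadic ball. -/
lemma step (H : ChainData ρ K σ s τ M R₀ z₀ S u h) {x y y' : X} {r : ℝ} (hr : 0 < r)
    (hy : y ∈ S) (hy' : y' ∈ S) (hxy : ρ x y < r) (hxy' : ρ x y' < r)
    (hhy : h y ≤ M * (r / 2) ^ (-τ)) (hhy' : h y' ≤ M * (r / 2) ^ (-τ)) :
    |u y - u y'| ≤ stepConst K σ s τ * M * r ^ (s - τ) := by
  have hK := H.one_le_K
  have hσ := H.one_le_σ
  have h1 : ρ y y' ≤ σ * K * r := by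
    refine (H.tri y y' x).trans ?_
    rw [mul_assoc]
    refine mul_le_mul_of_nonneg_left (max_le ?_ ?_) (by linarith)
    · exact (H.symm x y).trans (mul_le_mul_of_nonneg_left hxy.le (by linarith))
    · nlinarith
  calc |u y - u y'| ≤ ρ y y' ^ s * (h y + h y') := H.grad y hy y' hy'
    _ ≤ (σ * K * r) ^ s * (M * (r / 2) ^ (-τ) + M * (r / 2) ^ (-τ)) :=
        mul_le_mul (Real.rpow_le_rpow (H.nonneg _ _) h1 H.s_pos.le) (add_le_add hhy hhy')
          (add_nonneg (H.h_nonneg _) (H.h_nonneg _)) (by positivity)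
    _ = stepConst K σ s τ * M * r ^ (s - τ) := by
        rw [Real.mul_rpow (by positivity) hr.le, Real.div_rpow hr.le (by norm_num),
          Real.rpow_sub hr, Real.rpow_neg hr.le, Real.rpow_neg (by norm_num : (0:ℝ) ≤ 2)]
        unfold stepConst
        field_simp
        ring

lemma le_half (H : ChainData ρ K σ s τ M R₀ z₀ S u h) {a r : ℝ} (hr : 0 < r)
    (ha : a ≤ M * r ^ (-τ)) : a ≤ M * (r / 2) ^ (-τ) :=
  ha.trans (mul_le_mul_of_nonneg_left
    (Real.rpow_le_rpow_of_nonpos (by positivity) (by linarith) (by linarith [H.τ_pos])) H.M_nonneg)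

/-- The end point only has to be good at half the radius of its level. This is what makes the
induction close: a good point of level `n + 1` is an admissible end point of level `n`. -/
lemma chain (H : ChainData ρ K σ s τ M R₀ z₀ S u h) {x y₀ : X} {r : ℝ} (hx : ρ z₀ x < R₀)
    (hr : 0 < r) (hr' : r ≤ R₀) (hy₀ : y₀ ∈ S) (hxy₀ : ρ x y₀ < r) (hhy₀ : h y₀ ≤ M * r ^ (-τ))
    (n : ℕ) : ∀ y ∈ S, ρ x y < r * (1 / 2) ^ n → h y ≤ M * (r * (1 / 2) ^ n / 2) ^ (-τ) →
      |u y - u y₀| ≤ stepConst K σ s τ * M *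
        (r ^ (s - τ) * ∑ i ∈ Finset.range (n + 1), ((1 / 2 : ℝ) ^ (s - τ)) ^ i) := by
  have key : ∀ n : ℕ, (r * (1 / 2 : ℝ) ^ n) ^ (s - τ) = r ^ (s - τ) * ((1 / 2 : ℝ) ^ (s - τ)) ^ n := by
    intro n
    rw [Real.mul_rpow hr.le (by positivity), ← Real.rpow_natCast, ← Real.rpow_natCast,
      ← Real.rpow_mul (by norm_num), ← Real.rpow_mul (by norm_num), mul_comm (n : ℝ)]
  induction n with
  | zero =>
    intro y hy hxy hhy
    simp only [pow_zero, mul_one] at hxy hhy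
    simpa using H.step hr hy hy₀ hxy hxy₀ hhy (H.le_half hr hhy₀)
  | succ n ih =>
    intro y hy hxy hhy
    have hrn : 0 < r * (1 / 2 : ℝ) ^ (n + 1) := by positivity
    have hle : r * (1 / 2 : ℝ) ^ (n + 1) ≤ r :=
      mul_le_of_le_one_right hr.le (pow_le_one₀ (by norm_num) (by norm_num))
    obtain ⟨y', hy', hxy', hhy'⟩ := H.exists_good x hx _ hrn (hle.trans hr')
    have e : r * (1 / 2 : ℝ) ^ n / 2 = r * (1 / 2 : ℝ) ^ (n + 1) := by rw [pow_succ]; ring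
    have h1 := ih y' hy' (hxy'.trans (by rw [← e]; exact half_lt_self (by positivity)))
      (by rw [e]; exact hhy')
    have h2 := H.step hrn hy hy' hxy hxy' hhy (H.le_half hrn hhy')
    rw [key] at h2
    rw [Finset.sum_range_succ, mul_add, mul_add]
    calc |u y - u y₀| ≤ |u y' - u y₀| + |u y - u y'| := by
          rw [add_comm]; exact abs_sub_le _ _ _
      _ ≤ _ := add_le_add h1 h2

lemma chain_center (H : ChainData ρ K σ s τ M R₀ z₀ S u h) {x y₀ : X} {r : ℝ} (hx : ρ z₀ x < R₀)
    (hxS : x ∈ S) (hr : 0 < r) (hr' : r ≤ R₀) (hy₀ : y₀ ∈ S) (hxy₀ : ρ x y₀ < r)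
    (hhy₀ : h y₀ ≤ M * r ^ (-τ)) (n : ℕ) (hn : h x ≤ M * (r * (1 / 2) ^ n) ^ (-τ)) :
      |u x - u y₀| ≤ stepConst K σ s τ * M *
        (r ^ (s - τ) * ∑ i ∈ Finset.range (n + 1), ((1 / 2 : ℝ) ^ (s - τ)) ^ i) :=
  H.chain hx hr hr' hy₀ hxy₀ hhy₀ n x hxS (by rw [H.self]; positivity)
    (H.le_half (by positivity) hn)

/-- The right side grows like `2 ^ (τ n)` when `M > 0`; when `M = 0` it vanishes, and `pos_or`
supplies `h x = 0`. -/
lemma exists_level (H : ChainData ρ K σ s τ M R₀ z₀ S u h) {x : X} (hxS : x ∈ S) {r : ℝ}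
    (hr : 0 < r) : ∃ n : ℕ, h x ≤ M * (r * (1 / 2) ^ n) ^ (-τ) := by
  rcases H.pos_or with hM | h0
  · have hq : 1 < (2 : ℝ) ^ τ := Real.one_lt_rpow (by norm_num) H.τ_pos
    obtain ⟨n, hn⟩ := pow_unbounded_of_one_lt (h x / (M * r ^ (-τ))) hq
    refine ⟨n, ?_⟩
    have hrr : 0 < r ^ (-τ) := Real.rpow_pos_of_pos hr _
    rw [div_lt_iff₀ (by positivity)] at hn
    refine hn.le.trans (le_of_eq ?_)
    rw [Real.mul_rpow hr.le (by positivity), one_div, inv_pow, Real.inv_rpow (by positivity),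
      ← Real.rpow_neg (by positivity), neg_neg, ← Real.rpow_natCast, ← Real.rpow_natCast,
      ← Real.rpow_mul (by norm_num), ← Real.rpow_mul (by norm_num), mul_comm τ]
    ring
  · exact ⟨0, by rw [h0 x hxS]; have := H.M_nonneg; positivity⟩

/-- Needed because the reference point `z` ranges over `σ B₀`, outside the reach of a chain in `B(x,
R₀)`; a single crude gradient estimate across the large ball suffices. -/
lemma far (H : ChainData ρ K σ s τ M R₀ z₀ S u h) {y z : X} (hy : y ∈ S) (hz : z ∈ S)
    (hhy : h y ≤ M * R₀ ^ (-τ)) :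
    |u y - u z| ≤ (σ * K * σ) ^ s * (M * R₀ ^ (s - τ) + R₀ ^ s * h z) := by
  have hK := H.one_le_K
  have hσ := H.one_le_σ
  have hR := H.R_pos
  have h1 : ρ y z ≤ σ * K * σ * R₀ := by
    refine (H.tri y z z₀).trans ?_
    rw [mul_assoc, mul_assoc]
    refine mul_le_mul_of_nonneg_left (max_le ?_ ?_) (by linarith)
    · exact (H.symm z₀ y).trans (mul_le_mul_of_nonneg_left (H.mem_ball y hy).le (by linarith))
    · exact (H.mem_ball z hz).le.trans (le_mul_of_one_le_left (by positivity) hK)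
  calc |u y - u z| ≤ ρ y z ^ s * (h y + h z) := H.grad y hy z hz
    _ ≤ (σ * K * σ * R₀) ^ s * (M * R₀ ^ (-τ) + h z) :=
        mul_le_mul (Real.rpow_le_rpow (H.nonneg _ _) h1 H.s_pos.le) (by linarith)
          (add_nonneg (H.h_nonneg _) (H.h_nonneg _)) (by positivity)
    _ = _ := by
        rw [Real.mul_rpow (by positivity) hR.le, sub_eq_add_neg, Real.rpow_add hR]
        ring

end ChainData

/-! ### Pointwise estimates in the three regimes -/

/-- The constant in the pointwise estimate of the subcritical case. -/
def subcritConst (K σ s τ : ℝ) : ℝ :=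
  stepConst K σ s τ * (1 + ((1 / 2 : ℝ) ^ (s - τ)) ^ 2 / ((1 / 2 : ℝ) ^ (s - τ) - 1)) +
    (σ * K * σ) ^ s

lemma subcritConst_pos {K σ s τ : ℝ} (hK : 1 ≤ K) (hσ : 1 ≤ σ) (hsτ : s < τ) :
    0 < subcritConst K σ s τ := by
  have hq : 1 < (1 / 2 : ℝ) ^ (s - τ) :=
    Real.one_lt_rpow_of_pos_of_lt_one_of_neg (by norm_num) (by norm_num) (by linarith)
  have := stepConst_pos (s := s) (τ := τ) hK hσ
  have h1 : 0 < (1 / 2 : ℝ) ^ (s - τ) - 1 := by linarith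
  have h2 : 0 < σ * K * σ := by positivity
  unfold subcritConst
  positivity

namespace ChainData

variable {X : Type*} {ρ : X → X → ℝ} {K σ s τ M R₀ : ℝ} {z₀ : X} {S : Set X} {u h : X → ℝ}

lemma subcritical (H : ChainData ρ K σ s τ M R₀ z₀ S u h) (hsτ : s < τ) {x z : X}
    (hx : ρ z₀ x < R₀) (hxS : x ∈ S) (hz : z ∈ S) :
    |u x - u z| ≤ subcritConst K σ s τ *
      (M * R₀ ^ (s - τ) + R₀ ^ s * h z + M ^ (s / τ) * h x ^ (1 - s / τ)) := by
  classical
  have hR := H.R_pos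
  have hM := H.M_nonneg
  have hτ := H.τ_pos
  have hA := stepConst_pos (s := s) (τ := τ) H.one_le_K H.one_le_σ
  set A := stepConst K σ s τ with hAdef
  set q := (1 / 2 : ℝ) ^ (s - τ) with hqdef
  have hq : 1 < q :=
    Real.one_lt_rpow_of_pos_of_lt_one_of_neg (by norm_num) (by norm_num) (by linarith)
  have hq1 : 0 < q - 1 := by linarith
  obtain ⟨y₀, hy₀, hxy₀, hhy₀⟩ := H.exists_good x hx R₀ hR le_rfl
  have hex := H.exists_level hxS hR
  have hfar := H.far hy₀ hz hhy₀
  have hhx := H.h_nonneg x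
  have hhz := H.h_nonneg z
  have hRs : 0 < R₀ ^ (s - τ) := Real.rpow_pos_of_pos hR _
  have hmain : |u x - u y₀| ≤ A * (1 + q ^ 2 / (q - 1)) *
      (M * R₀ ^ (s - τ) + M ^ (s / τ) * h x ^ (1 - s / τ)) := by
    have hch := H.chain_center hx hxS hR le_rfl hy₀ hxy₀ hhy₀ (Nat.find hex) (Nat.find_spec hex)
    have hB : 0 ≤ q ^ 2 / (q - 1) := by positivity
    have hT : 0 ≤ M ^ (s / τ) * h x ^ (1 - s / τ) := by positivity
    rcases hn : Nat.find hex with _ | m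
    · rw [hn] at hch
      simp only [zero_add, Finset.range_one, Finset.sum_singleton, pow_zero, mul_one] at hch
      refine hch.trans ?_
      rw [mul_assoc, mul_assoc]
      refine mul_le_mul_of_nonneg_left ?_ hA.le
      have : 0 ≤ M * R₀ ^ (s - τ) := by positivity
      nlinarith [mul_nonneg hB this, mul_nonneg hB hT]
    · rw [hn] at hch
      -- Minimality of the level: the preceding level `m` fails, so the stopping radius is
      -- controlled by `h x` and the dominant last term of the sum can be expressed through `h x`.
      have hlt : M * (R₀ * (1 / 2) ^ m) ^ (-τ) < h x := by
        have := Nat.find_min hex (m := m) (by omega)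
        exact not_le.mp this
      have hrm : 0 < R₀ * (1 / 2 : ℝ) ^ m := by positivity
      have hxpos : 0 < h x := lt_of_le_of_lt (by positivity) hlt
      have hMpos : 0 < M := by
        rcases H.pos_or with h | h
        · exact h
        · exact absurd (h x hxS) hxpos.ne'
      have e1 : R₀ ^ (s - τ) * q ^ m = (R₀ * (1 / 2 : ℝ) ^ m) ^ (s - τ) := by
        rw [Real.mul_rpow hR.le (by positivity), hqdef, ← Real.rpow_natCast, ← Real.rpow_natCast,
          ← Real.rpow_mul (by norm_num), ← Real.rpow_mul (by norm_num), mul_comm (m : ℝ)]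
      have e2 : (R₀ * (1 / 2 : ℝ) ^ m) ^ (s - τ) ≤ (h x / M) ^ (1 - s / τ) := by
        have : (R₀ * (1 / 2 : ℝ) ^ m) ^ (s - τ)
            = ((R₀ * (1 / 2 : ℝ) ^ m) ^ (-τ)) ^ (1 - s / τ) := by
          rw [← Real.rpow_mul hrm.le]; congr 1; field_simp; ring
        rw [this]
        refine Real.rpow_le_rpow (by positivity) ?_ ?_
        · rw [le_div_iff₀ hMpos, mul_comm]; exact hlt.le
        · rw [sub_nonneg, div_le_one hτ]; exact hsτ.le
      have e3 : M * (h x / M) ^ (1 - s / τ) = M ^ (s / τ) * h x ^ (1 - s / τ) := by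
        have : M ^ (s / τ) = M / M ^ (1 - s / τ) := by
          rw [eq_div_iff (by positivity), ← Real.rpow_add hMpos]; simp
        rw [this, Real.div_rpow hhx hMpos.le]; ring
      -- The sum runs up to `m + 1`, one level past the failing one, hence `q ^ 2` rather than `q`.
      have e4 : ∑ i ∈ Finset.range (m + 1 + 1), q ^ i ≤ q ^ m * (q ^ 2 / (q - 1)) := by
        rw [geom_sum_eq hq.ne', mul_div_assoc', ← pow_add]
        gcongr
        linarith
      calc |u x - u y₀| ≤ A * M * (R₀ ^ (s - τ) * (q ^ m * (q ^ 2 / (q - 1)))) := by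
            refine hch.trans ?_
            gcongr
        _ = A * (q ^ 2 / (q - 1)) * (M * (R₀ * (1 / 2 : ℝ) ^ m) ^ (s - τ)) := by rw [← e1]; ring
        _ ≤ A * (q ^ 2 / (q - 1)) * (M * (h x / M) ^ (1 - s / τ)) := by gcongr
        _ = A * (q ^ 2 / (q - 1)) * (M ^ (s / τ) * h x ^ (1 - s / τ)) := by rw [e3]
        _ ≤ _ := by
            gcongr
            · linarith
            · have : 0 ≤ M * R₀ ^ (s - τ) := by positivity
              linarith
  have hE : 0 ≤ (σ * K * σ) ^ s := by
    have := H.one_le_K; have := H.one_le_σ; positivity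
  have hA' : 0 ≤ A * (1 + q ^ 2 / (q - 1)) := by positivity
  have t1 : 0 ≤ M * R₀ ^ (s - τ) := by positivity
  have t2 : 0 ≤ R₀ ^ s * h z := by positivity
  have t3 : 0 ≤ M ^ (s / τ) * h x ^ (1 - s / τ) := by positivity
  have := abs_sub_le (u x) (u y₀) (u z)
  unfold subcritConst
  rw [← hAdef, ← hqdef]
  nlinarith [mul_nonneg hE t3, mul_nonneg hA' t2]

/-- All increments are equal, so `|u x - u z| / M` is at most `A (n + 1) + 2 D`, with `A` the step
constant and `D` that of `far`. The rate `τ p log 2 / A` turns `A n` into `2 ^ (τ p n)`, which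
minimality of `n` bounds by a power of `h x`. -/
lemma critical (H : ChainData ρ K σ s τ M R₀ z₀ S u h) (hsτ : s = τ) (hM : 0 < M) {p : ℝ}
    (hp : 0 < p) {x z : X} (hx : ρ z₀ x < R₀) (hxS : x ∈ S) (hz : z ∈ S)
    (hhz : h z ≤ M * R₀ ^ (-τ)) :
    Real.exp (τ * p * Real.log 2 / stepConst K σ s τ * (|u x - u z| / M)) ≤
      2 ^ (τ * p) * Real.exp (τ * p * Real.log 2 * (1 + 2 * (σ * K * σ) ^ s / stepConst K σ s τ)) *
        (1 + (h x * R₀ ^ τ / M) ^ p) := by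
  classical
  have hR := H.R_pos
  have hτ := H.τ_pos
  have hA := stepConst_pos (s := s) (τ := τ) H.one_le_K H.one_le_σ
  set A := stepConst K σ s τ with hAdef
  set D := (σ * K * σ) ^ s with hD
  obtain ⟨y₀, hy₀, hxy₀, hhy₀⟩ := H.exists_good x hx R₀ hR le_rfl
  have hex := H.exists_level hxS hR
  have hfar := H.far hy₀ hz hhy₀
  have hhx := H.h_nonneg x
  have hch := H.chain_center hx hxS hR le_rfl hy₀ hxy₀ hhy₀ (Nat.find hex) (Nat.find_spec hex)
  set n := Nat.find hex with hndef
  have hD0 : 0 ≤ D := by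
    have := H.one_le_K; have := H.one_le_σ; positivity
  have hfar' : |u y₀ - u z| ≤ D * (2 * M) := by
    refine hfar.trans (mul_le_mul_of_nonneg_left ?_ hD0)
    have : R₀ ^ s * h z ≤ M := by
      refine (mul_le_mul_of_nonneg_left hhz (by positivity)).trans (le_of_eq ?_)
      rw [hsτ, Real.rpow_neg hR.le]; field_simp
    rw [hsτ] at this ⊢
    simp only [sub_self, Real.rpow_zero, mul_one]
    linarith
  have hch' : |u x - u y₀| ≤ A * M * (n + 1) := by
    refine hch.trans (le_of_eq ?_)
    rw [sub_eq_zero.2 hsτ]; simp [hAdef]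
  have hlev : (2 : ℝ) ^ (τ * p * n) ≤ 2 ^ (τ * p) * (1 + (h x * R₀ ^ τ / M) ^ p) := by
    rcases hn : n with _ | m
    · have h1 : 1 ≤ (2 : ℝ) ^ (τ * p) := Real.one_le_rpow (by norm_num) (by positivity)
      have h2 : 0 ≤ (h x * R₀ ^ τ / M) ^ p := by positivity
      simp only [Nat.cast_zero, mul_zero, Real.rpow_zero]
      nlinarith
    · have hlt : M * (R₀ * (1 / 2) ^ m) ^ (-τ) < h x :=
        not_le.mp (Nat.find_min hex (m := m) (by omega))
      have e : (R₀ * (1 / 2 : ℝ) ^ m) ^ (-τ) = 2 ^ (τ * m) * (R₀ ^ τ)⁻¹ := by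
        rw [Real.mul_rpow hR.le (by positivity), one_div, inv_pow, Real.inv_rpow (by positivity),
          ← Real.rpow_neg (by positivity), neg_neg, ← Real.rpow_natCast,
          ← Real.rpow_mul (by norm_num), Real.rpow_neg hR.le, mul_comm τ]
        ring
      have h3 : (2 : ℝ) ^ (τ * m) ≤ h x * R₀ ^ τ / M := by
        rw [e] at hlt
        rw [le_div_iff₀ hM]
        have hRτ : 0 < R₀ ^ τ := by positivity
        have := mul_lt_mul_of_pos_right hlt hRτ
        have e' : M * (2 ^ (τ * (m : ℝ)) * (R₀ ^ τ)⁻¹) * R₀ ^ τ = 2 ^ (τ * (m : ℝ)) * M := by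
          field_simp
        linarith
      calc (2 : ℝ) ^ (τ * p * ((m + 1 : ℕ) : ℝ)) = 2 ^ (τ * p) * (2 ^ (τ * m)) ^ p := by
            rw [← Real.rpow_mul (by norm_num), ← Real.rpow_add (by norm_num)]
            congr 1; push_cast; ring
        _ ≤ _ := by
            gcongr
            have := Real.rpow_le_rpow (by positivity) h3 hp.le
            linarith
  have hlog : 0 < Real.log 2 := Real.log_pos (by norm_num)
  have hub : |u x - u z| ≤ A * M * (n + 1) + D * (2 * M) :=
    (abs_sub_le (u x) (u y₀) (u z)).trans (add_le_add hch' hfar')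
  calc Real.exp (τ * p * Real.log 2 / A * (|u x - u z| / M))
      ≤ Real.exp (τ * p * Real.log 2 / A * ((A * M * (n + 1) + D * (2 * M)) / M)) := by
        gcongr
    _ = 2 ^ (τ * p * n) * Real.exp (τ * p * Real.log 2 * (1 + 2 * D / A)) := by
        rw [Real.rpow_def_of_pos (by norm_num), ← Real.exp_add]
        congr 1; field_simp; ring
    _ ≤ (2 ^ (τ * p) * (1 + (h x * R₀ ^ τ / M) ^ p)) *
          Real.exp (τ * p * Real.log 2 * (1 + 2 * D / A)) := by gcongr
    _ = _ := by ring

lemma supercritical_osc (H : ChainData ρ K σ s τ M R₀ z₀ S u h) (hsτ : τ < s) {x y y₀ : X}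
    {r t : ℝ} (hx : ρ z₀ x < R₀) (ht : 0 < t) (htr : t ≤ r) (hr' : r ≤ R₀) (hy : y ∈ S)
    (hxy : ρ x y < t) (hhy : h y ≤ M * t ^ (-τ)) (hy₀ : y₀ ∈ S) (hxy₀ : ρ x y₀ < r)
    (hhy₀ : h y₀ ≤ M * r ^ (-τ)) :
    |u y - u y₀| ≤ stepConst K σ s τ / (1 - (1 / 2 : ℝ) ^ (s - τ)) * (M * r ^ (s - τ)) := by
  have hr : 0 < r := ht.trans_le htr
  have hM := H.M_nonneg
  have hA := stepConst_pos (s := s) (τ := τ) H.one_le_K H.one_le_σ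
  have hq0 : 0 < (1 / 2 : ℝ) ^ (s - τ) := by positivity
  have hq : (1 / 2 : ℝ) ^ (s - τ) < 1 :=
    Real.rpow_lt_one (by norm_num) (by norm_num) (by linarith)
  -- The dyadic level with `r / 2 ^ (n + 1) < t ≤ r / 2 ^ n`: the upper bound places `y` in the ball
  -- of level `n`, the lower one gives goodness at half its radius.
  obtain ⟨n, hn1, hn2⟩ := exists_nat_pow_near_of_lt_one (x := t / r) (y := (1 / 2 : ℝ))
    (by positivity) ((div_le_one hr).2 htr) (by norm_num) (by norm_num)
  rw [lt_div_iff₀ hr] at hn1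
  rw [div_le_iff₀ hr] at hn2
  have h1 := H.chain hx hr hr' hy₀ hxy₀ hhy₀ n y hy (hxy.trans_le (by linarith)) (by
    refine hhy.trans (mul_le_mul_of_nonneg_left ?_ hM)
    refine Real.rpow_le_rpow_of_nonpos (by positivity) ?_ (by linarith [H.τ_pos])
    rw [pow_succ] at hn1
    linarith)
  refine h1.trans ?_
  have h2 : ∑ i ∈ Finset.range (n + 1), ((1 / 2 : ℝ) ^ (s - τ)) ^ i
      ≤ (1 - (1 / 2 : ℝ) ^ (s - τ))⁻¹ := by
    rw [← tsum_geometric_of_lt_one hq0.le hq]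
    exact (summable_geometric_of_lt_one hq0.le hq).sum_le_tsum _ (fun i _ => by positivity)
  calc _ ≤ stepConst K σ s τ * M * (r ^ (s - τ) * (1 - (1 / 2 : ℝ) ^ (s - τ))⁻¹) := by gcongr
    _ = _ := by ring

end ChainData

/-- The oscillation constant in the supercritical case. -/
def oscConst (K σ s τ : ℝ) : ℝ := stepConst K σ s τ / (1 - (1 / 2 : ℝ) ^ (s - τ))

lemma oscConst_pos {K σ s τ : ℝ} (hK : 1 ≤ K) (hσ : 1 ≤ σ) (hsτ : τ < s) :
    0 < oscConst K σ s τ := by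
  have hq : (1 / 2 : ℝ) ^ (s - τ) < 1 :=
    Real.rpow_lt_one (by norm_num) (by norm_num) (by linarith)
  exact div_pos (stepConst_pos hK hσ) (by linarith)

/-- The Hölder constant in the supercritical case. -/
def holderConst (K σ s τ : ℝ) : ℝ :=
  2 * oscConst K σ s τ + (σ * (σ * (σ * K) * K)) ^ s * 2

lemma holderConst_pos {K σ s τ : ℝ} (hK : 1 ≤ K) (hσ : 1 ≤ σ) (hsτ : τ < s) :
    0 < holderConst K σ s τ := by
  have := oscConst_pos (K := K) hK hσ hsτ
  have h2 : 0 < σ * (σ * (σ * K) * K) := by positivity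
  unfold holderConst; positivity

namespace ChainData

variable {X : Type*} {ρ : X → X → ℝ} {K σ s τ M R₀ : ℝ} {z₀ : X} {S : Set X} {u h : X → ℝ}

/-- The value at `x` of the Hölder representative. A point of `S` is good for its own small balls,
so `u x` itself works; elsewhere `u` is Cauchy along good points, and the oscillation bound passes
to the limit. -/
lemma exists_limit (H : ChainData ρ K σ s τ M R₀ z₀ S u h) (hsτ : τ < s) {x : X}
    (hx : ρ z₀ x < R₀) :
    ∃ w : ℝ, (x ∈ S → w = u x) ∧ ∀ r, 0 < r → r ≤ R₀ → ∀ y ∈ S, ρ x y < r → h y ≤ M * r ^ (-τ) →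
      |w - u y| ≤ oscConst K σ s τ * (M * r ^ (s - τ)) := by
  have hR := H.R_pos
  by_cases hxS : x ∈ S
  · refine ⟨u x, fun _ => rfl, fun r hr hr' y hy hxy hhy => ?_⟩
    obtain ⟨n, hn⟩ := H.exists_level hxS hr
    have hle : r * (1 / 2 : ℝ) ^ n ≤ r :=
      mul_le_of_le_one_right hr.le (pow_le_one₀ (by norm_num) (by norm_num))
    exact H.supercritical_osc hsτ hx (by positivity) hle hr' hxS (by rw [H.self]; positivity) hn
      hy hxy hhy
  · have hrn : ∀ n : ℕ, 0 < R₀ * (1 / 2 : ℝ) ^ n := fun n => by positivity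
    have hanti : Antitone fun n : ℕ => R₀ * (1 / 2 : ℝ) ^ n := fun m n hmn =>
      mul_le_mul_of_nonneg_left (pow_le_pow_of_le_one (by norm_num) (by norm_num) hmn) hR.le
    have hle : ∀ n : ℕ, R₀ * (1 / 2 : ℝ) ^ n ≤ R₀ := fun n => by simpa using hanti (Nat.zero_le n)
    choose y hyS hxy hhy using fun n => H.exists_good x hx _ (hrn n) (hle n)
    have hr0 : Filter.Tendsto (fun n : ℕ => R₀ * (1 / 2 : ℝ) ^ n) Filter.atTop (nhds 0) := by
      simpa using (tendsto_pow_atTop_nhds_zero_of_lt_one (by norm_num : (0 : ℝ) ≤ 1 / 2)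
        (by norm_num)).const_mul R₀
    have hlim : Filter.Tendsto (fun n : ℕ => oscConst K σ s τ *
        (M * (R₀ * (1 / 2 : ℝ) ^ n) ^ (s - τ))) Filter.atTop (nhds 0) := by
      have := (((hr0.rpow_const (p := s - τ) (Or.inr (by linarith))).const_mul M).const_mul
        (oscConst K σ s τ))
      rwa [Real.zero_rpow (by linarith), mul_zero, mul_zero] at this
    have hc : CauchySeq fun n => u (y n) := by
      refine cauchySeq_of_le_tendsto_0' _ (fun n m hnm => ?_) hlim
      rw [Real.dist_eq, abs_sub_comm]
      exact H.supercritical_osc hsτ hx (hrn m) (hanti hnm) (hle n) (hyS m) (hxy m) (hhy m)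
        (hyS n) (hxy n) (hhy n)
    obtain ⟨w, hw⟩ := cauchySeq_tendsto_of_complete hc
    refine ⟨w, fun h => absurd h hxS, fun r hr hr' y' hy' hxy' hhy' => ?_⟩
    refine le_of_tendsto (hw.sub_const (u y')).abs ?_
    filter_upwards [hr0.eventually_le_const hr] with n hn
    exact H.supercritical_osc hsτ hx (hrn n) hn hr' (hyS n) (hxy n) (hhy n) hy' hxy' hhy'

lemma supercritical (H : ChainData ρ K σ s τ M R₀ z₀ S u h) (hsτ : τ < s) :
    ∃ v : X → ℝ, (∀ x ∈ S, ρ z₀ x < R₀ → v x = u x) ∧ ∀ x, ρ z₀ x < R₀ → ∀ y, ρ z₀ y < R₀ →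
      |v x - v y| ≤ holderConst K σ s τ * (M * ρ x y ^ (s - τ)) := by
  classical
  have hR := H.R_pos
  have hM := H.M_nonneg
  have hK := H.one_le_K
  have hσ := H.one_le_σ
  choose! v hv1 hv2 using fun x (hx : ρ z₀ x < R₀) => H.exists_limit hsτ hx
  refine ⟨v, fun x hxS hx => hv1 x hx hxS, fun x hx y hy => ?_⟩
  by_cases hxy : x = y
  · rw [hxy, H.self, Real.zero_rpow (by linarith)]; simp
  have hρ := H.pos_of_ne x y hxy
  -- Good points are available only up to radius `R₀`, while `ρ x y` may exceed it, but only by the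
  -- factor `σ K`. Both centres use this common radius.
  set r := min R₀ (ρ x y) with hrdef
  have hr : 0 < r := lt_min hR hρ
  have hrR : r ≤ R₀ := min_le_left _ _
  obtain ⟨x', hx', hxx', hhx'⟩ := H.exists_good x hx r hr hrR
  obtain ⟨y', hy', hyy', hhy'⟩ := H.exists_good y hy r hr hrR
  have hσK : 1 ≤ σ * K := by nlinarith
  have hρr : ρ x y ≤ σ * K * r := by
    rcases le_total R₀ (ρ x y) with h | h
    · rw [hrdef, min_eq_left h, mul_assoc]
      refine (H.tri x y z₀).trans (mul_le_mul_of_nonneg_left (max_le ?_ ?_) (by linarith))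
      · exact (H.symm z₀ x).trans (mul_le_mul_of_nonneg_left hx.le (by linarith))
      · nlinarith
    · rw [hrdef, min_eq_right h]; nlinarith
  have h1 : ρ x y' ≤ σ * (σ * K) * r := by
    rw [mul_assoc σ]
    refine (H.tri x y' y).trans (mul_le_mul_of_nonneg_left (max_le hρr ?_) (by linarith))
    nlinarith
  have h2 : ρ x' y' ≤ σ * (σ * (σ * K) * K) * r := by
    rw [mul_assoc σ]
    have h0 : 1 ≤ σ * (σ * K) := by nlinarith
    refine (H.tri x' y' x).trans (mul_le_mul_of_nonneg_left (max_le ?_ ?_) (by linarith))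
    · refine (H.symm x x').trans ?_
      have : K * ρ x x' ≤ K * r := mul_le_mul_of_nonneg_left hxx'.le (by linarith)
      have : K * r ≤ (σ * (σ * K)) * (K * r) := le_mul_of_one_le_left (by positivity) h0
      linarith
    · refine h1.trans ?_
      have : σ * (σ * K) * r ≤ K * (σ * (σ * K) * r) := le_mul_of_one_le_left (by positivity) hK
      linarith
  have h3 : |u x' - u y'| ≤ (σ * (σ * (σ * K) * K)) ^ s * 2 * (M * r ^ (s - τ)) := by
    calc |u x' - u y'| ≤ ρ x' y' ^ s * (h x' + h y') := H.grad x' hx' y' hy'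
      _ ≤ (σ * (σ * (σ * K) * K) * r) ^ s * (M * r ^ (-τ) + M * r ^ (-τ)) :=
          mul_le_mul (Real.rpow_le_rpow (H.nonneg _ _) h2 H.s_pos.le) (add_le_add hhx' hhy')
            (add_nonneg (H.h_nonneg _) (H.h_nonneg _)) (by positivity)
      _ = _ := by
          rw [Real.mul_rpow (by positivity) hr.le, sub_eq_add_neg, Real.rpow_add hr]
          ring
  have h4 := hv2 x hx r hr hrR x' hx' hxx' hhx'
  have h5 := hv2 y hy r hr hrR y' hy' hyy' hhy'
  have h6 : |v x - v y| ≤ holderConst K σ s τ * (M * r ^ (s - τ)) := by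
    have a1 := abs_sub_le (v x) (u x') (v y)
    have a2 := abs_sub_le (u x') (u y') (v y)
    rw [abs_sub_comm (u y')] at a2
    unfold holderConst
    linarith
  refine h6.trans ?_
  have := holderConst_pos hK hσ hsτ
  have : r ^ (s - τ) ≤ ρ x y ^ (s - τ) :=
    Real.rpow_le_rpow hr.le (min_le_right _ _) (by linarith)
  gcongr

end ChainData

/-! ### The quasi-metric constant and inclusions of balls -/

section QuasiMetric

variable {X : Type*} {ρ : X → X → ℝ}

lemma IsQuasiMetric.le_of_quasiConst_le (hρ : IsQuasiMetric ρ) {σ : ℝ} (hσ : quasiConst ρ ≤ σ)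
    (x y z : X) : ρ x y ≤ σ * max (ρ x z) (ρ z y) := by
  obtain ⟨K₁, hK₁, hK⟩ := hρ.quasi_subadd
  by_cases hxyz : x = y ∧ y = z
  · obtain ⟨rfl, rfl⟩ := hxyz
    simp [(hρ.eq_zero_iff x x).2 rfl]
  have hmax : ∀ x y z : X, ¬ (x = y ∧ y = z) → 0 < max (ρ x z) (ρ z y) := by
    intro x y z hne
    by_contra hle
    have h1 : ρ x z = 0 := le_antisymm ((le_max_left _ _).trans (not_lt.1 hle)) (hρ.nonneg _ _)
    have h2 : ρ z y = 0 := le_antisymm ((le_max_right _ _).trans (not_lt.1 hle)) (hρ.nonneg _ _)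
    rw [hρ.eq_zero_iff] at h1 h2
    exact hne ⟨h1.trans h2, h2.symm⟩
  -- A real `sSup` dominates the elements of its set only if the set is bounded above; `K₁` provides
  -- the bound.
  have hbdd : BddAbove {t : ℝ | ∃ x y z : X, ¬ (x = y ∧ y = z) ∧
      t = ρ x y / max (ρ x z) (ρ z y)} := by
    refine ⟨K₁, ?_⟩
    rintro t ⟨x, y, z, hne, rfl⟩
    rw [div_le_iff₀ (hmax x y z hne)]
    exact hK x y z
  rw [← div_le_iff₀ (hmax x y z hxyz)]
  exact (le_csSup hbdd ⟨x, y, z, hxyz, rfl⟩).trans hσ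

lemma IsQuasiMetric.one_le_of_quasiConst_le [Nontrivial X] (hρ : IsQuasiMetric ρ) {σ : ℝ}
    (hσ : quasiConst ρ ≤ σ) : 1 ≤ σ := by
  obtain ⟨x, y, hxy⟩ := exists_pair_ne X
  have h := hρ.le_of_quasiConst_le hσ x y y
  have hpos : 0 < ρ x y := lt_of_le_of_ne (hρ.nonneg _ _) fun h => hxy ((hρ.eq_zero_iff x y).1 h.symm)
  rw [(hρ.eq_zero_iff y y).2 rfl, max_eq_left hpos.le] at h
  exact le_of_mul_le_mul_right (by linarith) hpos

/-- The constant controlling both quasi-symmetry and `1`. -/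
lemma IsQuasiMetric.exists_symm (hρ : IsQuasiMetric ρ) :
    ∃ K : ℝ, 1 ≤ K ∧ ∀ x y, ρ y x ≤ K * ρ x y := by
  obtain ⟨K₀, -, h⟩ := hρ.quasi_symm
  exact ⟨max K₀ 1, le_max_right _ _, fun x y =>
    (h x y).trans (mul_le_mul_of_nonneg_right (le_max_left _ _) (hρ.nonneg _ _))⟩

/-- This is where `σ ≥ C_ρ` makes the volume condition applicable to every ball of radius at most
`R₀` centred in `B₀`. -/
lemma qball_subset_of_le (hρ : IsQuasiMetric ρ) {σ : ℝ} (hσ : quasiConst ρ ≤ σ) (hσ1 : 1 ≤ σ)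
    {z₀ x : X} {R₀ r : ℝ} (hx : ρ z₀ x < R₀) (hr : r ≤ R₀) :
    qball ρ x r ⊆ qball ρ z₀ (σ * R₀) := fun y hy => by
  refine (hρ.le_of_quasiConst_le hσ z₀ y x).trans_lt ?_
  exact mul_lt_mul_of_pos_left (max_lt hx (lt_of_lt_of_le hy hr)) (by linarith)

lemma qball_subset_qball_mul {σ R₀ : ℝ} {z₀ : X} (hσ1 : 1 ≤ σ) (hR : 0 < R₀) :
    qball ρ z₀ R₀ ⊆ qball ρ z₀ (σ * R₀) := fun _ hx =>
  lt_of_lt_of_le hx (le_mul_of_one_le_left hR.le hσ1)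

end QuasiMetric

/-! ### From the volume condition to good points -/

section Measure

variable {X : Type*} {ρ : X → X → ℝ} [MeasurableSpace X] {μ : Measure X} {s p σ Q R₀ b : ℝ}
  {z₀ : X} {u : X → ℝ} {g : X → ℝ≥0∞}

lemma lintegral_eq_lpNormOn_rpow (hp : 0 < p) (A : Set X) (g : X → ℝ≥0∞) :
    ∫⁻ x in A, g x ^ p ∂μ = lpNormOn μ A p g ^ p := by
  rw [lpNormOn, ← ENNReal.rpow_mul, one_div, inv_mul_cancel₀ hp.ne', ENNReal.rpow_one]

/-- The average of `g ^ p` over a large enough subset of the ball. -/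
lemma laverage_rpow_le (hp : 0 < p) (hb : 0 < b) {A B : Set X} (hAB : A ⊆ B) {r : ℝ} (hr : 0 < r)
    (hA : ENNReal.ofReal (b * r ^ Q) ≤ μ A) (hG : lpNormOn μ B p g ≠ ∞) :
    ⨍⁻ x in A, g x ^ p ∂μ ≤
      ENNReal.ofReal (((lpNormOn μ B p g).toReal * b ^ (-(1 / p)) * r ^ (-(Q / p))) ^ p) := by
  rw [setLAverage_eq]
  have h0 : 0 < b * r ^ Q := by positivity
  calc _ ≤ (∫⁻ x in B, g x ^ p ∂μ) / ENNReal.ofReal (b * r ^ Q) :=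
        ENNReal.div_le_div (lintegral_mono_set hAB) hA
    _ = ENNReal.ofReal ((lpNormOn μ B p g).toReal ^ p / (b * r ^ Q)) := by
        rw [lintegral_eq_lpNormOn_rpow hp, ENNReal.ofReal_div_of_pos h0,
          ← ENNReal.ofReal_rpow_of_nonneg ENNReal.toReal_nonneg hp.le, ENNReal.ofReal_toReal hG]
    _ = _ := by
        congr 1
        rw [Real.mul_rpow (by positivity) (by positivity),
          Real.mul_rpow ENNReal.toReal_nonneg (by positivity), ← Real.rpow_mul hb.le,
          ← Real.rpow_mul hr.le, show -(1 / p) * p = -1 by field_simp,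
          show -(Q / p) * p = -Q by field_simp, Real.rpow_neg hr.le, Real.rpow_neg_one]
        field_simp

/-- The measure of `σ B₀` cancels, so the gradient term is `M R₀ ^ (s - τ)`, the natural size of an
increment at scale `R₀`. -/
lemma gradientTerm_eq (hp : 0 < p) (hb : 0 < b) (hR : 0 < R₀)
    (h0 : μ (qball ρ z₀ (σ * R₀)) ≠ 0) (htop : μ (qball ρ z₀ (σ * R₀)) ≠ ∞) :
    gradientTerm ρ μ z₀ R₀ σ Q b s p g =
      ENNReal.ofReal (b ^ (-(1 / p)) * R₀ ^ (s - Q / p)) *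
        lpNormOn μ (qball ρ z₀ (σ * R₀)) p g := by
  have hc : 0 < b * R₀ ^ Q := by positivity
  have e : b ^ (-(1 / p)) * R₀ ^ (s - Q / p) = R₀ ^ s * ((b * R₀ ^ Q)⁻¹) ^ (1 / p) := by
    rw [Real.inv_rpow hc.le, Real.mul_rpow hb.le (by positivity), ← Real.rpow_mul hR.le,
      Real.rpow_neg hb.le, Real.rpow_sub hR, show Q * (1 / p) = Q / p by ring]
    field_simp
  have e2 : ENNReal.ofReal (((b * R₀ ^ Q)⁻¹) ^ (1 / p)) =
      ((ENNReal.ofReal (b * R₀ ^ Q))⁻¹) ^ (1 / p) := by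
    rw [← ENNReal.ofReal_rpow_of_pos (inv_pos.2 hc), ENNReal.ofReal_inv_of_pos hc]
  rw [e, ENNReal.ofReal_mul (by positivity), e2, gradientTerm, setLAverage_eq, lpNormOn]
  generalize μ (qball ρ z₀ (σ * R₀)) = m at *
  generalize ∫⁻ x in qball ρ z₀ (σ * R₀), g x ^ p ∂μ = I
  generalize ENNReal.ofReal (b * R₀ ^ Q) = c
  have e3 : m / c * (I / m) = c⁻¹ * I := by
    calc m / c * (I / m) = c⁻¹ * I * (m * m⁻¹) := by rw [div_eq_mul_inv, div_eq_mul_inv]; ring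
      _ = c⁻¹ * I := by rw [ENNReal.mul_inv_cancel h0 htop, mul_one]
  rw [mul_right_comm, ← ENNReal.mul_rpow_of_nonneg _ _ (by positivity), e3,
    ENNReal.mul_rpow_of_nonneg _ _ (by positivity)]
  ring

/-- A function takes a value not exceeding its average outside any given null set; applied to `g ^
p` on `B(x, r)`, this produces the good points. -/
lemma exists_chainData (hρ : IsQuasiMetric ρ) {K : ℝ} (hK : 1 ≤ K)
    (hKρ : ∀ x y, ρ y x ≤ K * ρ x y) (hs : 0 < s) (hp : 0 < p) (hσ : quasiConst ρ ≤ σ)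
    (hσ1 : 1 ≤ σ) (hQ : 0 < Q) (hμ : IsQuasiMetricMeasure ρ μ) (hR : 0 < R₀) (hb : 0 < b)
    (hV : VCondition ρ μ z₀ R₀ σ Q b) (hg : IsGradient ρ μ (qball ρ z₀ (σ * R₀)) s u g)
    (hG : lpNormOn μ (qball ρ z₀ (σ * R₀)) p g ≠ ∞) :
    ∃ (S : Set X) (h : X → ℝ),
      ChainData ρ K σ s (Q / p) ((lpNormOn μ (qball ρ z₀ (σ * R₀)) p g).toReal * b ^ (-(1 / p)))
        R₀ z₀ S u h ∧
      (∀ᵐ x ∂μ.restrict (qball ρ z₀ (σ * R₀)), x ∈ S) ∧ ∀ x ∈ S, g x = ENNReal.ofReal (h x) := by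
  obtain ⟨E, hE, hgrad⟩ := hg.le
  set B := qball ρ z₀ (σ * R₀) with hB
  set G := lpNormOn μ B p g with hGdef
  have hσR : 0 < σ * R₀ := by positivity
  have hI := lintegral_eq_lpNormOn_rpow (μ := μ) hp B g
  have hgp : AEMeasurable (fun x => g x ^ p) (μ.restrict B) := hg.aemeasurable.pow_const p
  have hfin : ∀ᵐ x ∂μ.restrict B, g x ≠ ∞ := by
    have h1 : ∫⁻ x in B, g x ^ p ∂μ ≠ ∞ := by
      rw [hI]; exact ENNReal.rpow_ne_top_of_nonneg hp.le hG
    filter_upwards [ae_lt_top' hgp h1] with x hx htop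
    simp [htop, hp] at hx
  have hzero : ∀ᵐ x ∂μ.restrict B, G = 0 → g x = 0 := by
    by_cases hG0 : G = 0
    · rw [← hGdef, hG0, ENNReal.zero_rpow_of_pos hp, lintegral_eq_zero_iff' hgp] at hI
      filter_upwards [hI] with x hx _
      simpa [hp, hp.le, not_lt.2 hp.le] using hx
    · exact Filter.Eventually.of_forall fun x h => absurd h hG0
  have hmem : ∀ᵐ x ∂μ.restrict B, x ∈ B := ae_restrict_mem₀ (hμ.ball_measurable z₀ _ hσR)
  have hnE : ∀ᵐ x ∂μ.restrict B, x ∉ E := ae_restrict_of_ae (measure_eq_zero_iff_ae_notMem.1 hE)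
  -- Discarded are the exceptional set of the gradient inequality, the points with `g = ∞`, and,
  -- when the norm is zero, those with `g ≠ 0`. The last condition secures `pos_or`.
  set S : Set X := {x | x ∈ B ∧ x ∉ E ∧ g x ≠ ∞ ∧ (G = 0 → g x = 0)} with hS
  have hSae : ∀ᵐ x ∂μ.restrict B, x ∈ S := by
    filter_upwards [hfin, hzero, hmem, hnE] with x h1 h2 h3 h4 using ⟨h3, h4, h1, h2⟩
  have hM : 0 ≤ G.toReal * b ^ (-(1 / p)) := by positivity
  refine ⟨S, fun x => (g x).toReal, ?_, hSae, fun x hx => (ENNReal.ofReal_toReal hx.2.2.1).symm⟩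
  refine
    { nonneg := hρ.nonneg
      self := fun x => (hρ.eq_zero_iff x x).2 rfl
      pos_of_ne := fun x y hxy =>
        lt_of_le_of_ne (hρ.nonneg _ _) fun h => hxy ((hρ.eq_zero_iff x y).1 h.symm)
      symm := hKρ
      tri := hρ.le_of_quasiConst_le hσ
      one_le_K := hK
      one_le_σ := hσ1
      s_pos := hs
      τ_pos := by positivity
      M_nonneg := hM
      R_pos := hR
      h_nonneg := fun x => ENNReal.toReal_nonneg
      mem_ball := fun x hx => hx.1
      grad := ?_
      exists_good := ?_
      pos_or := ?_ }
  · intro x hx y hy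
    have h := hgrad x ⟨hx.1, hx.2.1⟩ y ⟨hy.1, hy.2.1⟩
    have hρs : 0 ≤ ρ x y ^ s := Real.rpow_nonneg (hρ.nonneg _ _) _
    rw [← ENNReal.ofReal_toReal hx.2.2.1, ← ENNReal.ofReal_toReal hy.2.2.1,
      ← ENNReal.ofReal_add ENNReal.toReal_nonneg ENNReal.toReal_nonneg,
      ← ENNReal.ofReal_mul hρs] at h
    exact (ENNReal.ofReal_le_ofReal_iff
      (mul_nonneg hρs (add_nonneg ENNReal.toReal_nonneg ENNReal.toReal_nonneg))).1 h
  · intro x hx r hr hrR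
    have hsub : qball ρ x r ⊆ B := qball_subset_of_le hρ hσ hσ1 hx hrR
    have hVr := hV x r hr (hrR.trans (by nlinarith)) hsub
    have hle := laverage_rpow_le (g := g) hp hb hsub hr hVr hG
    have : Fact (μ (qball ρ x r) < ∞) := ⟨hμ.ball_lt_top x r hr⟩
    have hrestr : μ.restrict (qball ρ x r) ≤ μ.restrict B := Measure.restrict_mono hsub le_rfl
    have hN : ∀ᵐ y ∂μ.restrict (qball ρ x r), y ∈ S ∧ y ∈ qball ρ x r := by
      filter_upwards [ae_mono hrestr hSae, ae_restrict_mem₀ (hμ.ball_measurable x r hr)] with y h1 h2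
        using ⟨h1, h2⟩
    obtain ⟨y, hy, hgy⟩ := exists_notMem_null_le_laverage
      (by rw [Ne, Measure.restrict_eq_zero]; exact (hμ.ball_pos x r hr).ne')
      (hgp.mono_measure hrestr) (ae_iff.1 hN)
    simp only [mem_ofPred_eq, not_not] at hy
    refine ⟨y, hy.1, hy.2, ?_⟩
    have h1 := hgy.trans hle
    have hpos : 0 ≤ G.toReal * b ^ (-(1 / p)) * r ^ (-(Q / p)) := by positivity
    rw [← ENNReal.ofReal_rpow_of_nonneg hpos hp.le, ENNReal.rpow_le_rpow_iff hp] at h1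
    exact ENNReal.toReal_le_of_le_ofReal hpos h1
  · by_cases hG0 : G = 0
    · exact Or.inr fun x hx => by simp [hx.2.2.2 hG0]
    · exact Or.inl (mul_pos (ENNReal.toReal_pos hG0 hG) (by positivity))

lemma MemHajlasz.exists_gradient {A : Set X} (hu : MemHajlasz ρ μ A s p u) :
    ∃ g : X → ℝ≥0∞, IsGradient ρ μ A s u g ∧ lpNormOn μ A p g ≠ ∞ := by
  have h := hu.seminorm_lt_top
  simp only [hajlaszSeminorm, iInf_lt_top] at h
  obtain ⟨g, hg, hlt⟩ := h
  exact ⟨g, hg, hlt.ne⟩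

end Measure

/-! ### Quasi-norm inequalities for averages -/

lemma ennreal_add_rpow_le {q : ℝ} (hq : 0 < q) (a b : ℝ≥0∞) :
    (a + b) ^ q ≤ 2 ^ q * (a ^ q + b ^ q) := by
  have h1 : a + b ≤ 2 * max a b := by
    rw [two_mul]; exact add_le_add (le_max_left _ _) (le_max_right _ _)
  refine (ENNReal.rpow_le_rpow h1 hq.le).trans ?_
  rw [ENNReal.mul_rpow_of_nonneg _ _ hq.le]
  gcongr
  rcases le_total a b with h | h
  · rw [max_eq_right h]; exact le_add_self
  · rw [max_eq_left h]; exact le_self_add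

section

variable {X : Type*} [MeasurableSpace X] {ν : Measure X}

lemma laverage_const_add_le (c : ℝ≥0∞) (f : X → ℝ≥0∞) :
    ⨍⁻ x, (c + f x) ∂ν ≤ c + ⨍⁻ x, f x ∂ν := by
  rw [laverage, lintegral_add_left measurable_const, lintegral_const]
  refine add_le_add (mul_le_of_le_one_right' ?_) le_rfl
  rw [Measure.smul_apply, smul_eq_mul]
  exact ENNReal.inv_mul_le_one _

lemma laverage_mono_of_ae {f f' : X → ℝ≥0∞} (h : ∀ᵐ x ∂ν, f x ≤ f' x) :
    ⨍⁻ x, f x ∂ν ≤ ⨍⁻ x, f' x ∂ν :=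
  lintegral_mono_ae (Measure.ae_smul_measure h _)

lemma laverage_const_mul_of_ne_top {c : ℝ≥0∞} (hc : c ≠ ∞) (f : X → ℝ≥0∞) :
    ⨍⁻ x, c * f x ∂ν = c * ⨍⁻ x, f x ∂ν := lintegral_const_mul' _ _ hc

/-- A substitute for Minkowski's inequality: the exponent `p^*` may be less than `1`, where only a
quasi-triangle inequality holds. No measurability is required. -/
lemma laverage_rpow_le_of_ae {q : ℝ} (hq : 0 < q) {φ f : X → ℝ≥0∞} {c D T : ℝ≥0∞} (hD : D ≠ ∞)
    (hφ : ∀ᵐ x ∂ν, φ x ≤ c + D * f x) (hf : ⨍⁻ x, f x ^ q ∂ν ≤ T ^ q) :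
    (⨍⁻ x, φ x ^ q ∂ν) ^ (1 / q) ≤ 2 * 2 ^ (1 / q) * (c + D * T) := by
  have hq' : 0 < 1 / q := by positivity
  have h1 : ⨍⁻ x, φ x ^ q ∂ν ≤ 2 ^ q * (c ^ q + (D * T) ^ q) := by
    calc _ ≤ ⨍⁻ x, 2 ^ q * (c ^ q + D ^ q * f x ^ q) ∂ν := by
          refine laverage_mono_of_ae ?_
          filter_upwards [hφ] with x hx
          rw [← ENNReal.mul_rpow_of_nonneg _ _ hq.le]
          exact (ENNReal.rpow_le_rpow hx hq.le).trans (ennreal_add_rpow_le hq _ _)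
      _ = 2 ^ q * ⨍⁻ x, (c ^ q + D ^ q * f x ^ q) ∂ν :=
          laverage_const_mul_of_ne_top (ENNReal.rpow_ne_top_of_nonneg hq.le (by simp)) _
      _ ≤ 2 ^ q * (c ^ q + ⨍⁻ x, D ^ q * f x ^ q ∂ν) := by
          gcongr; exact laverage_const_add_le _ _
      _ = 2 ^ q * (c ^ q + D ^ q * ⨍⁻ x, f x ^ q ∂ν) := by
          rw [laverage_const_mul_of_ne_top (ENNReal.rpow_ne_top_of_nonneg hq.le hD)]
      _ ≤ _ := by rw [ENNReal.mul_rpow_of_nonneg _ _ hq.le]; gcongr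
  have h2 : ∀ a : ℝ≥0∞, (a ^ q) ^ (1 / q) = a := fun a => by
    rw [← ENNReal.rpow_mul, mul_one_div_cancel hq.ne', ENNReal.rpow_one]
  calc _ ≤ (2 ^ q * (c ^ q + (D * T) ^ q)) ^ (1 / q) := ENNReal.rpow_le_rpow h1 hq'.le
    _ = 2 * (c ^ q + (D * T) ^ q) ^ (1 / q) := by
        rw [ENNReal.mul_rpow_of_nonneg _ _ hq'.le, h2]
    _ ≤ 2 * (2 ^ (1 / q) * ((c ^ q) ^ (1 / q) + ((D * T) ^ q) ^ (1 / q))) := by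
        gcongr; exact ennreal_add_rpow_le hq' _ _
    _ = _ := by rw [h2, h2, mul_assoc]

end

/-! ### Averaged estimates in the three regimes -/

namespace ChainData

variable {X : Type*} [MeasurableSpace X] {ν : Measure X} {ρ : X → X → ℝ}
  {K σ s p Q M R₀ : ℝ} {z₀ : X} {S : Set X} {u h : X → ℝ} {g : X → ℝ≥0∞}

/-- The choice of `p^*` makes `(1 - s/τ) p^* = p`, so the dominant term becomes `g ^ p`; the powers
of `M` and `R₀` then recombine to `(M R₀ ^ (s - τ)) ^ p^*`. The function `φ` covers both `|u - u
z|`, with `c = 0`, and `|u|`, with `c = |u z|`. -/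
lemma subcritical_laverage (H : ChainData ρ K σ s (Q / p) M R₀ z₀ S u h) (hp : 0 < p)
    (hQ : 0 < Q) (hpQ : p < Q / s) (hν : ∀ᵐ x ∂ν, x ∈ S ∧ ρ z₀ x < R₀)
    (hgS : ∀ x ∈ S, g x = ENNReal.ofReal (h x))
    (hg : ⨍⁻ x, g x ^ p ∂ν ≤ ENNReal.ofReal ((M * R₀ ^ (-(Q / p))) ^ p)) {z : X} (hz : z ∈ S)
    {φ : X → ℝ≥0∞} {c : ℝ≥0∞} (hφ : ∀ x, φ x ≤ c + ENNReal.ofReal |u x - u z|) :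
    (⨍⁻ x, φ x ^ sobolevExp Q s p ∂ν) ^ (1 / sobolevExp Q s p) ≤
      2 * 2 ^ (1 / sobolevExp Q s p) * (c + ENNReal.ofReal (subcritConst K σ s (Q / p)) *
        (2 * ENNReal.ofReal (M * R₀ ^ (s - Q / p)) + ENNReal.ofReal (R₀ ^ s * h z))) := by
  have hs := H.s_pos
  have hR := H.R_pos
  have hM := H.M_nonneg
  have hsp : 0 < Q - s * p := by rw [lt_div_iff₀ hs] at hpQ; linarith
  have hsτ : s < Q / p := by rw [lt_div_iff₀ hp]; linarith
  set q := sobolevExp Q s p with hqdef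
  have hq : 0 < q := by rw [hqdef, sobolevExp]; positivity
  set Cs := subcritConst K σ s (Q / p) with hCs
  have hCs0 : 0 < Cs := subcritConst_pos H.one_le_K H.one_le_σ hsτ
  have e1 : (1 - s / (Q / p)) * q = p := by rw [hqdef, sobolevExp]; field_simp
  have e2 : s / (Q / p) * q + p = q := by rw [hqdef, sobolevExp]; field_simp; ring
  have e3 : (s - Q / p) * q = -(Q / p) * p := by rw [hqdef, sobolevExp]; field_simp; ring
  have hθ : 0 ≤ 1 - s / (Q / p) := by
    rw [sub_nonneg, div_le_one (by positivity)]; exact hsτ.le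
  have key := laverage_rpow_le_of_ae (ν := ν) hq (φ := φ)
    (f := fun x => ENNReal.ofReal (M ^ (s / (Q / p))) * g x ^ (1 - s / (Q / p)))
    (c := c + ENNReal.ofReal Cs * (ENNReal.ofReal (M * R₀ ^ (s - Q / p)) +
      ENNReal.ofReal (R₀ ^ s * h z))) (D := ENNReal.ofReal Cs)
    (T := ENNReal.ofReal (M * R₀ ^ (s - Q / p))) ENNReal.ofReal_ne_top ?_ ?_
  · refine key.trans (le_of_eq ?_)
    ring
  · filter_upwards [hν] with x hx
    have hhx := H.h_nonneg x
    have hhz := H.h_nonneg z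
    have h1 := H.subcritical hsτ hx.2 hx.1 hz
    refine (hφ x).trans ?_
    rw [add_assoc, ← mul_add]
    gcongr
    refine (ENNReal.ofReal_le_ofReal h1).trans (le_of_eq ?_)
    rw [← hCs, ENNReal.ofReal_mul hCs0.le, ENNReal.ofReal_add (by positivity) (by positivity),
      ENNReal.ofReal_add (by positivity) (by positivity), hgS x hx.1,
      ENNReal.ofReal_rpow_of_nonneg hhx hθ, ENNReal.ofReal_mul (p := M ^ _) (by positivity)]
  · calc _ = ⨍⁻ x, ENNReal.ofReal (M ^ (s / (Q / p))) ^ q * g x ^ p ∂ν := by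
          simp only [ENNReal.mul_rpow_of_nonneg _ _ hq.le, ← ENNReal.rpow_mul, e1]
      _ = ENNReal.ofReal (M ^ (s / (Q / p))) ^ q * ⨍⁻ x, g x ^ p ∂ν :=
          laverage_const_mul_of_ne_top
            (ENNReal.rpow_ne_top_of_nonneg hq.le ENNReal.ofReal_ne_top) _
      _ ≤ ENNReal.ofReal (M ^ (s / (Q / p))) ^ q *
            ENNReal.ofReal ((M * R₀ ^ (-(Q / p))) ^ p) := by gcongr
      _ = _ := by
          rw [ENNReal.ofReal_rpow_of_nonneg (by positivity) hq.le,
            ENNReal.ofReal_rpow_of_nonneg (by positivity) hq.le,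
            ← ENNReal.ofReal_mul (by positivity)]
          congr 1
          rw [Real.mul_rpow hM (by positivity), Real.mul_rpow hM (by positivity),
            ← Real.rpow_mul hM, ← Real.rpow_mul hR.le, ← Real.rpow_mul hR.le, e3, ← mul_assoc,
            ← Real.rpow_add_of_nonneg hM (by positivity) hp.le, e2]

/-- The constant in the subcritical Sobolev inequalities. -/
def _root_.HajlaszEmbedding.sobolevConst (K σ s p Q : ℝ) : ℝ :=
  2 * 2 ^ (1 / sobolevExp Q s p) *
    ((1 + subcritConst K σ s (Q / p)) * 2 ^ (1 / p) + 3 * subcritConst K σ s (Q / p))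

lemma subcritical_oscillation (H : ChainData ρ K σ s (Q / p) M R₀ z₀ S u h) (hp : 0 < p)
    (hQ : 0 < Q) (hpQ : p < Q / s) (hν : ∀ᵐ x ∂ν, x ∈ S ∧ ρ z₀ x < R₀)
    (hgS : ∀ x ∈ S, g x = ENNReal.ofReal (h x))
    (hg : ⨍⁻ x, g x ^ p ∂ν ≤ ENNReal.ofReal ((M * R₀ ^ (-(Q / p))) ^ p)) :
    ∃ γ : ℝ, (⨍⁻ x, ENNReal.ofReal |u x - γ| ^ sobolevExp Q s p ∂ν) ^ (1 / sobolevExp Q s p) ≤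
      ENNReal.ofReal (sobolevConst K σ s p Q) * ENNReal.ofReal (M * R₀ ^ (s - Q / p)) := by
  have hs := H.s_pos
  have hR := H.R_pos
  have hM := H.M_nonneg
  have hsp : 0 < Q - s * p := by rw [lt_div_iff₀ hs] at hpQ; linarith
  have hsτ : s < Q / p := by rw [lt_div_iff₀ hp]; linarith
  have hCs0 := subcritConst_pos (s := s) H.one_le_K H.one_le_σ hsτ
  -- A good point at scale `R₀` around the centre; the constant `γ = u z` works because `R₀ ^ s h z`
  -- is absorbed by the gradient term.
  obtain ⟨z, hz, -, hhz⟩ := H.exists_good z₀ (by rw [H.self]; exact hR) R₀ hR le_rfl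
  refine ⟨u z, (H.subcritical_laverage hp hQ hpQ hν hgS hg hz (c := 0)
    (fun x => by rw [zero_add])).trans ?_⟩
  have h1 : R₀ ^ s * h z ≤ M * R₀ ^ (s - Q / p) := by
    refine (mul_le_mul_of_nonneg_left hhz (by positivity)).trans (le_of_eq ?_)
    rw [sub_eq_add_neg, Real.rpow_add hR]; ring
  have h2 : (2 : ℝ≥0∞) ^ (1 / sobolevExp Q s p) = ENNReal.ofReal (2 ^ (1 / sobolevExp Q s p)) := by
    rw [← ENNReal.ofReal_rpow_of_pos (by norm_num)]; simp
  have h3 : (2 : ℝ≥0∞) = ENNReal.ofReal 2 := by simp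
  rw [h2, h3, zero_add]
  have hhz0 := H.h_nonneg z
  rw [← ENNReal.ofReal_mul (by positivity), ← ENNReal.ofReal_mul (by positivity),
    ← ENNReal.ofReal_add (by positivity) (by positivity), ← ENNReal.ofReal_mul (by positivity),
    ← ENNReal.ofReal_mul (by positivity), ← ENNReal.ofReal_mul (by unfold sobolevConst; positivity)]
  refine ENNReal.ofReal_le_ofReal ?_
  unfold sobolevConst
  rw [mul_assoc (2 * 2 ^ (1 / sobolevExp Q s p) : ℝ)]
  refine mul_le_mul_of_nonneg_left ?_ (by positivity)
  have h4 : 0 ≤ (1 + subcritConst K σ s (Q / p)) * 2 ^ (1 / p) * (M * R₀ ^ (s - Q / p)) := by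
    positivity
  nlinarith [mul_le_mul_of_nonneg_left h1 hCs0.le]

lemma subcritical_norm (H : ChainData ρ K σ s (Q / p) M R₀ z₀ S u h) (hp : 0 < p)
    (hQ : 0 < Q) (hpQ : p < Q / s) (hν : ∀ᵐ x ∂ν, x ∈ S ∧ ρ z₀ x < R₀)
    (hgS : ∀ x ∈ S, g x = ENNReal.ofReal (h x))
    (hg : ⨍⁻ x, g x ^ p ∂ν ≤ ENNReal.ofReal ((M * R₀ ^ (-(Q / p))) ^ p))
    {ν' : Measure X} [IsFiniteMeasure ν'] (hν'0 : ν' ≠ 0) (hν' : ∀ᵐ x ∂ν', x ∈ S)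
    (hg' : ⨍⁻ x, g x ^ p ∂ν' ≤ ENNReal.ofReal ((M * R₀ ^ (-(Q / p))) ^ p))
    (hgm : AEMeasurable g ν') (hum : AEMeasurable u ν') :
    (⨍⁻ x, ENNReal.ofReal |u x| ^ sobolevExp Q s p ∂ν) ^ (1 / sobolevExp Q s p) ≤
      ENNReal.ofReal (sobolevConst K σ s p Q) * ENNReal.ofReal (M * R₀ ^ (s - Q / p)) +
      ENNReal.ofReal (sobolevConst K σ s p Q) *
        (⨍⁻ x, ENNReal.ofReal |u x| ^ p ∂ν') ^ (1 / p) := by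
  have hs := H.s_pos
  have hR := H.R_pos
  have hM := H.M_nonneg
  have hsp : 0 < Q - s * p := by rw [lt_div_iff₀ hs] at hpQ; linarith
  have hsτ : s < Q / p := by rw [lt_div_iff₀ hp]; linarith
  have hCs0 := subcritConst_pos (s := s) H.one_le_K H.one_le_σ hsτ
  set W := (⨍⁻ x, ENNReal.ofReal |u x| ^ p ∂ν') ^ (1 / p) with hW
  set T := ENNReal.ofReal (M * R₀ ^ (s - Q / p)) with hT
  have hWp : ⨍⁻ x, ENNReal.ofReal |u x| ^ p ∂ν' = W ^ p := by
    rw [hW, ← ENNReal.rpow_mul, one_div, inv_mul_cancel₀ hp.ne', ENNReal.rpow_one]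
  -- A single reference point must make both `|u z|` and `R₀ ^ s g z` small; comparing the sum of
  -- their `p`-th powers with its average achieves this.
  set F : X → ℝ≥0∞ := fun x => ENNReal.ofReal |u x| ^ p + (ENNReal.ofReal (R₀ ^ s) * g x) ^ p
    with hF
  have hm1 : AEMeasurable (fun x => ENNReal.ofReal |u x| ^ p) ν' :=
    (ENNReal.measurable_ofReal.comp_aemeasurable
      (continuous_abs.measurable.comp_aemeasurable hum)).pow_const p
  have hFm : AEMeasurable F ν' := hm1.add ((hgm.const_mul _).pow_const p)
  obtain ⟨z, hz, hFz⟩ := exists_notMem_null_le_laverage hν'0 hFm (ae_iff.1 hν')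
  simp only [mem_ofPred_eq, not_not] at hz
  have hFavg : ⨍⁻ x, F x ∂ν' ≤ W ^ p + T ^ p := by
    have e : ⨍⁻ x, F x ∂ν' = ⨍⁻ x, ENNReal.ofReal |u x| ^ p ∂ν' +
        ⨍⁻ x, (ENNReal.ofReal (R₀ ^ s) * g x) ^ p ∂ν' :=
      lintegral_add_left' (hm1.smul_measure _) _
    rw [e, hWp]
    gcongr
    calc _ = ⨍⁻ x, ENNReal.ofReal (R₀ ^ s) ^ p * g x ^ p ∂ν' := by
          simp only [ENNReal.mul_rpow_of_nonneg _ _ hp.le]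
      _ = ENNReal.ofReal (R₀ ^ s) ^ p * ⨍⁻ x, g x ^ p ∂ν' :=
          laverage_const_mul_of_ne_top
            (ENNReal.rpow_ne_top_of_nonneg hp.le ENNReal.ofReal_ne_top) _
      _ ≤ ENNReal.ofReal (R₀ ^ s) ^ p * ENNReal.ofReal ((M * R₀ ^ (-(Q / p))) ^ p) := by gcongr
      _ = T ^ p := by
          rw [← ENNReal.ofReal_rpow_of_nonneg (by positivity) hp.le,
            ← ENNReal.mul_rpow_of_nonneg _ _ hp.le, ← ENNReal.ofReal_mul (by positivity), hT]
          congr 2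
          rw [sub_eq_add_neg, Real.rpow_add hR]; ring
  have hroot : ∀ a : ℝ≥0∞, a ^ p ≤ F z → a ≤ 2 ^ (1 / p) * (W + T) := by
    intro a ha
    have hp' : 0 < 1 / p := by positivity
    have h2 : ∀ a : ℝ≥0∞, (a ^ p) ^ (1 / p) = a := fun a => by
      rw [← ENNReal.rpow_mul, mul_one_div_cancel hp.ne', ENNReal.rpow_one]
    rw [← h2 a, ← h2 W, ← h2 T]
    refine (ENNReal.rpow_le_rpow (ha.trans (hFz.trans hFavg)) hp'.le).trans ?_
    rw [h2, h2]
    refine (ennreal_add_rpow_le hp' _ _).trans ?_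
    rw [h2, h2]
  have hu := hroot (ENNReal.ofReal |u z|) le_self_add
  have hh : ENNReal.ofReal (R₀ ^ s * h z) ≤ 2 ^ (1 / p) * (W + T) := by
    rw [ENNReal.ofReal_mul (by positivity), ← hgS z hz]
    exact hroot _ le_add_self
  have hmain := H.subcritical_laverage hp hQ hpQ hν hgS hg hz (φ := fun x => ENNReal.ofReal |u x|)
    (c := ENNReal.ofReal |u z|) (fun x => by
      rw [← ENNReal.ofReal_add (abs_nonneg _) (abs_nonneg _)]
      refine ENNReal.ofReal_le_ofReal ?_
      have := abs_add_le (u z) (u x - u z)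
      simpa using this)
  have hC : ENNReal.ofReal (sobolevConst K σ s p Q) = 2 * 2 ^ (1 / sobolevExp Q s p) *
      ((1 + ENNReal.ofReal (subcritConst K σ s (Q / p))) * 2 ^ (1 / p) +
        3 * ENNReal.ofReal (subcritConst K σ s (Q / p))) := by
    unfold sobolevConst
    rw [ENNReal.ofReal_mul (by positivity), ENNReal.ofReal_mul (by positivity),
      ENNReal.ofReal_add (by positivity) (by positivity), ENNReal.ofReal_mul (by positivity),
      ENNReal.ofReal_mul (by positivity), ENNReal.ofReal_add (by positivity) (by positivity),
      ← ENNReal.ofReal_rpow_of_pos (by norm_num), ← ENNReal.ofReal_rpow_of_pos (by norm_num)]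
    simp
  rw [hC]
  generalize ENNReal.ofReal (subcritConst K σ s (Q / p)) = D at *
  generalize (2 : ℝ≥0∞) ^ (1 / sobolevExp Q s p) = κ at *
  generalize (2 : ℝ≥0∞) ^ (1 / p) = t at *
  calc _ ≤ 2 * κ * (ENNReal.ofReal |u z| + D * (2 * T + ENNReal.ofReal (R₀ ^ s * h z))) := hmain
    _ ≤ 2 * κ * (t * (W + T) + D * (2 * T + t * (W + T))) := by gcongr
    _ ≤ 2 * κ * (t * (W + T) + D * (2 * T + t * (W + T))) + 2 * κ * D * (T + 3 * W) := le_self_add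
    _ = _ := by ring

end ChainData

/-- The exponential rate in the critical case. -/
def expRate (K σ s p Q : ℝ) : ℝ := Q / p * p * Real.log 2 / stepConst K σ s (Q / p)

/-- The multiplicative constant of the pointwise exponential estimate. -/
def expBound (K σ s p Q : ℝ) : ℝ :=
  2 ^ (Q / p * p) *
    Real.exp (Q / p * p * Real.log 2 * (1 + 2 * (σ * K * σ) ^ s / stepConst K σ s (Q / p)))

lemma expRate_pos {K σ s p Q : ℝ} (hK : 1 ≤ K) (hσ : 1 ≤ σ) (hp : 0 < p) (hQ : 0 < Q) :
    0 < expRate K σ s p Q := by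
  have := stepConst_pos (s := s) (τ := Q / p) hK hσ
  have : 0 < Real.log 2 := Real.log_pos (by norm_num)
  unfold expRate; positivity

lemma expBound_pos {K σ s p Q : ℝ} : 0 < expBound K σ s p Q := by
  unfold expBound; positivity

/-- The bound for the exponential average. -/
def expAverageBound (K σ s p Q : ℝ) : ℝ :=
  1 + expBound K σ s p Q * 2 * Real.exp (expBound K σ s p Q * 2)

lemma memLp_of_laverage_lt_top {X : Type*} [MeasurableSpace X] {ν : Measure X} [IsFiniteMeasure ν]
    {u : X → ℝ} (hu : AEMeasurable u ν) (γ : ℝ) {q : ℝ} (hq : 0 < q)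
    (h : (⨍⁻ x, ENNReal.ofReal |u x - γ| ^ q ∂ν) ^ (1 / q) < ∞) :
    MemLp u (ENNReal.ofReal q) ν := by
  have h1 : ⨍⁻ x, ENNReal.ofReal |u x - γ| ^ q ∂ν < ∞ := by
    by_contra hc
    rw [not_lt_top_iff.1 hc, ENNReal.top_rpow_of_pos (by positivity)] at h
    exact lt_irrefl _ h
  have h2 : MemLp (fun x => u x - γ) (ENNReal.ofReal q) ν := by
    refine ⟨(hu.sub_const γ).aestronglyMeasurable, ?_⟩
    rw [eLpNorm_lt_top_iff_lintegral_rpow_enorm_lt_top (by simpa using hq) ENNReal.ofReal_ne_top,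
      ENNReal.toReal_ofReal hq.le]
    simp only [Real.enorm_eq_ofReal_abs]
    rw [← measure_mul_laverage]
    exact ENNReal.mul_lt_top (measure_lt_top _ _) h1
  convert h2.add (memLp_const γ) using 1
  ext x; simp

namespace ChainData

variable {X : Type*} [MeasurableSpace X] {ν : Measure X} {ρ : X → X → ℝ}
  {K σ s p Q M R₀ : ℝ} {z₀ : X} {S : Set X} {u h : X → ℝ} {g : X → ℝ≥0∞}

/-- The pointwise estimate controls the deviation from `u z`. Since `t ≤ exp t`, it also bounds `|u
z - u_{B₀}|` by a multiple of `M`, so replacing `u z` by the mean costs only the factor `exp (2 B)`.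
-/
lemma critical_laverage (H : ChainData ρ K σ s (Q / p) M R₀ z₀ S u h) (hp : 0 < p)
    (hQ : 0 < Q) (hsQ : s = Q / p) (hM : 0 < M) [IsFiniteMeasure ν] [NeZero ν]
    (hν : ∀ᵐ x ∂ν, x ∈ S ∧ ρ z₀ x < R₀) (hum : AEMeasurable u ν)
    (hgS : ∀ x ∈ S, g x = ENNReal.ofReal (h x))
    (hg : ⨍⁻ x, g x ^ p ∂ν ≤ ENNReal.ofReal ((M * R₀ ^ (-(Q / p))) ^ p)) :
    Integrable u ν ∧
    ⨍⁻ x, ENNReal.ofReal (Real.exp (expRate K σ s p Q * (|u x - ⨍ y, u y ∂ν| / M))) ∂ν ≤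
      ENNReal.ofReal (expAverageBound K σ s p Q) := by
  have hR := H.R_pos
  have hc := expRate_pos (s := s) H.one_le_K H.one_le_σ hp hQ
  have hB := expBound_pos (K := K) (σ := σ) (s := s) (p := p) (Q := Q)
  set c := expRate K σ s p Q with hcdef
  set B := expBound K σ s p Q with hBdef
  obtain ⟨z, hz, -, hhz⟩ := H.exists_good z₀ (by rw [H.self]; exact hR) R₀ hR le_rfl
  set F : X → ℝ := fun x => 1 + (h x * R₀ ^ (Q / p) / M) ^ p with hF
  have hF0 : ∀ x, 0 ≤ F x := fun x => by have := H.h_nonneg x; simp only [hF]; positivity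
  have hexp : ∀ᵐ x ∂ν, Real.exp (c * (|u x - u z| / M)) ≤ B * F x := by
    filter_upwards [hν] with x hx
    exact H.critical hsQ hM hp hx.2 hx.1 hz hhz
  -- The normalisation by `M` is exactly such that `(g R₀ ^ τ / M) ^ p` has average at most `1`.
  have hFavg : ⨍⁻ x, ENNReal.ofReal (F x) ∂ν ≤ 2 := by
    calc _ ≤ ⨍⁻ x, (1 + ENNReal.ofReal (R₀ ^ (Q / p) / M) ^ p * g x ^ p) ∂ν := by
          refine laverage_mono_of_ae ?_
          filter_upwards [hν] with x hx
          have := H.h_nonneg x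
          simp only [hF]
          rw [hgS x hx.1, ENNReal.ofReal_add zero_le_one (by positivity), ENNReal.ofReal_one,
            ← ENNReal.mul_rpow_of_nonneg _ _ hp.le, ← ENNReal.ofReal_mul (by positivity),
            ENNReal.ofReal_rpow_of_nonneg (by positivity) hp.le, mul_div_assoc, mul_comm (h x)]
      _ ≤ 1 + ⨍⁻ x, ENNReal.ofReal (R₀ ^ (Q / p) / M) ^ p * g x ^ p ∂ν :=
          laverage_const_add_le _ _
      _ = 1 + ENNReal.ofReal (R₀ ^ (Q / p) / M) ^ p * ⨍⁻ x, g x ^ p ∂ν := by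
          rw [laverage_const_mul_of_ne_top
            (ENNReal.rpow_ne_top_of_nonneg hp.le ENNReal.ofReal_ne_top)]
      _ ≤ 1 + ENNReal.ofReal (R₀ ^ (Q / p) / M) ^ p *
            ENNReal.ofReal ((M * R₀ ^ (-(Q / p))) ^ p) := by gcongr
      _ = 2 := by
          rw [← ENNReal.ofReal_rpow_of_nonneg (by positivity) hp.le,
            ← ENNReal.mul_rpow_of_nonneg _ _ hp.le, ← ENNReal.ofReal_mul (by positivity),
            show R₀ ^ (Q / p) / M * (M * R₀ ^ (-(Q / p))) = 1 by
              rw [Real.rpow_neg hR.le]; field_simp]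
          simp [one_add_one_eq_two]
  have hdev : ⨍⁻ x, ‖u x - u z‖ₑ ∂ν ≤ ENNReal.ofReal (M / c * B * 2) := by
    calc _ ≤ ⨍⁻ x, ENNReal.ofReal (M / c * B) * ENNReal.ofReal (F x) ∂ν := by
          refine laverage_mono_of_ae ?_
          filter_upwards [hexp] with x hx
          rw [Real.enorm_eq_ofReal_abs, ← ENNReal.ofReal_mul (by positivity)]
          refine ENNReal.ofReal_le_ofReal ?_
          have h1 := Real.add_one_le_exp (c * (|u x - u z| / M))
          have h2 : c * (|u x - u z| / M) ≤ B * F x := by linarith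
          calc |u x - u z| = M / c * (c * (|u x - u z| / M)) := by field_simp
            _ ≤ M / c * (B * F x) := by gcongr
            _ = _ := by ring
      _ = ENNReal.ofReal (M / c * B) * ⨍⁻ x, ENNReal.ofReal (F x) ∂ν :=
          laverage_const_mul_of_ne_top ENNReal.ofReal_ne_top _
      _ ≤ ENNReal.ofReal (M / c * B) * 2 := by gcongr
      _ = _ := by rw [ENNReal.ofReal_mul (q := 2) (by positivity)]; simp
  have hint' : Integrable (fun x => u x - u z) ν := by
    refine ⟨(hum.sub_const _).aestronglyMeasurable, ?_⟩
    rw [HasFiniteIntegral, ← measure_mul_laverage]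
    exact ENNReal.mul_lt_top (measure_lt_top _ _) (hdev.trans_lt ENNReal.ofReal_lt_top)
  have hint : Integrable u ν := by
    refine (hint'.add (integrable_const (u z))).congr (Filter.Eventually.of_forall fun x => ?_)
    simp
  refine ⟨hint, ?_⟩
  have hmean : |u z - ⨍ y, u y ∂ν| ≤ M / c * B * 2 := by
    have e : ⨍ y, (u y - u z) ∂ν = ⨍ y, u y ∂ν - u z := by
      have h1 : Integrable u ((ν univ)⁻¹ • ν) :=
        hint.smul_measure (by simp [NeZero.ne ν])
      have h2 : Integrable (fun _ : X => u z) ((ν univ)⁻¹ • ν) :=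
        (integrable_const _).smul_measure (by simp [NeZero.ne ν])
      calc ⨍ y, (u y - u z) ∂ν = ⨍ y, u y ∂ν - ⨍ _, u z ∂ν := integral_sub h1 h2
        _ = _ := by rw [average_const]
    have h1 : ‖⨍ y, (u y - u z) ∂ν‖ₑ ≤ ⨍⁻ x, ‖u x - u z‖ₑ ∂ν := enorm_integral_le_lintegral_enorm _
    have h2 := h1.trans hdev
    rw [e, Real.enorm_eq_ofReal_abs, ENNReal.ofReal_le_ofReal_iff (by positivity)] at h2
    rwa [abs_sub_comm]
  calc _ ≤ ⨍⁻ x, ENNReal.ofReal (B * Real.exp (B * 2)) * ENNReal.ofReal (F x) ∂ν := by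
        refine laverage_mono_of_ae ?_
        filter_upwards [hexp] with x hx
        rw [← ENNReal.ofReal_mul (by positivity)]
        refine ENNReal.ofReal_le_ofReal ?_
        have h1 : c * (|u x - ⨍ y, u y ∂ν| / M) ≤ c * (|u x - u z| / M) + B * 2 := by
          calc _ ≤ c * ((|u x - u z| + M / c * B * 2) / M) := by
                gcongr
                exact (abs_sub_le _ (u z) _).trans (by gcongr)
            _ = _ := by field_simp
        calc _ ≤ Real.exp (c * (|u x - u z| / M) + B * 2) := Real.exp_le_exp.2 h1
          _ = Real.exp (c * (|u x - u z| / M)) * Real.exp (B * 2) := Real.exp_add _ _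
          _ ≤ B * F x * Real.exp (B * 2) := by gcongr
          _ = _ := by ring
    _ = ENNReal.ofReal (B * Real.exp (B * 2)) * ⨍⁻ x, ENNReal.ofReal (F x) ∂ν :=
        laverage_const_mul_of_ne_top ENNReal.ofReal_ne_top _
    _ ≤ ENNReal.ofReal (B * Real.exp (B * 2)) * 2 := by gcongr
    _ = ENNReal.ofReal (B * 2 * Real.exp (B * 2)) := by
        rw [show B * 2 * Real.exp (B * 2) = B * Real.exp (B * 2) * 2 by ring,
          ENNReal.ofReal_mul (q := 2) (by positivity)]
        simp
    _ ≤ _ := by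
        refine ENNReal.ofReal_le_ofReal ?_
        unfold expAverageBound
        rw [← hBdef]; linarith

/-- The degenerate case `M = 0`, in which `u` is constant almost everywhere. -/
lemma integrable_of_forall_eq_zero (H : ChainData ρ K σ s (Q / p) M R₀ z₀ S u h)
    (h0 : ∀ x ∈ S, h x = 0) [IsFiniteMeasure ν] (hν : ∀ᵐ x ∂ν, x ∈ S) : Integrable u ν := by
  have hR := H.R_pos
  obtain ⟨z, hz, -⟩ := H.exists_good z₀ (by rw [H.self]; exact hR) R₀ hR le_rfl
  refine (integrable_const (u z)).congr ?_
  filter_upwards [hν] with x hx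
  have := H.grad x hx z hz
  rw [h0 x hx, h0 z hz, add_zero, mul_zero] at this
  exact (sub_eq_zero.1 (abs_nonpos_iff.1 this)).symm

/-- The constant bounding the deviation from the average in the supercritical case. -/
def _root_.HajlaszEmbedding.morreyConst (K σ s p Q : ℝ) : ℝ :=
  holderConst K σ s (Q / p) * (σ * K) ^ (s - Q / p)

lemma supercritical_eLpNorm (H : ChainData ρ K σ s (Q / p) M R₀ z₀ S u h)
    (hsQ : Q / p < s) [IsFiniteMeasure ν] [NeZero ν]
    (hν : ∀ᵐ x ∂ν, x ∈ S ∧ ρ z₀ x < R₀) (hum : AEMeasurable u ν) :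
    Integrable u ν ∧ eLpNorm (fun x => u x - ⨍ y, u y ∂ν) ∞ ν ≤
      ENNReal.ofReal (morreyConst K σ s p Q * (M * R₀ ^ (s - Q / p))) ∧
      ∃ v : X → ℝ, v =ᵐ[ν] u ∧ ∀ x, ρ z₀ x < R₀ → ∀ y, ρ z₀ y < R₀ →
        |v x - v y| ≤ holderConst K σ s (Q / p) * (M * ρ x y ^ (s - Q / p)) := by
  have hR := H.R_pos
  have hM := H.M_nonneg
  have hK := H.one_le_K
  have hσ := H.one_le_σ
  obtain ⟨v, hv1, hv2⟩ := H.supercritical hsQ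
  have hosc : ∀ x ∈ S, ρ z₀ x < R₀ → ∀ y ∈ S, ρ z₀ y < R₀ →
      |u x - u y| ≤ morreyConst K σ s p Q * (M * R₀ ^ (s - Q / p)) := by
    intro x hx hx' y hy hy'
    have h1 := hv2 x hx' y hy'
    rw [hv1 x hx hx', hv1 y hy hy'] at h1
    have h2 : ρ x y ≤ σ * K * R₀ := by
      rw [mul_assoc]
      refine (H.tri x y z₀).trans (mul_le_mul_of_nonneg_left (max_le ?_ ?_) (by linarith))
      · exact (H.symm z₀ x).trans (mul_le_mul_of_nonneg_left hx'.le (by linarith))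
      · nlinarith
    have h3 := Real.rpow_le_rpow (H.nonneg _ _) h2 (by linarith : 0 ≤ s - Q / p)
    rw [Real.mul_rpow (by positivity) hR.le] at h3
    have := holderConst_pos hK hσ hsQ
    calc _ ≤ _ := h1
      _ ≤ holderConst K σ s (Q / p) * (M * ((σ * K) ^ (s - Q / p) * R₀ ^ (s - Q / p))) := by gcongr
      _ = _ := by unfold morreyConst; ring
  obtain ⟨z, hz, hzR, -⟩ := H.exists_good z₀ (by rw [H.self]; exact hR) R₀ hR le_rfl
  have hint : Integrable u ν := by
    refine Integrable.of_bound hum.aestronglyMeasurable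
      (|u z| + morreyConst K σ s p Q * (M * R₀ ^ (s - Q / p))) ?_
    filter_upwards [hν] with x hx
    have h1 := hosc x hx.1 hx.2 z hz hzR
    have h2 := abs_add_le (u z) (u x - u z)
    rw [add_sub_cancel] at h2
    rw [Real.norm_eq_abs]
    linarith
  refine ⟨hint, ?_, v, ?_, hv2⟩
  · refine eLpNormEssSup_le_of_ae_bound ?_
    filter_upwards [hν] with x hx
    -- Almost all values of `u` lie in a closed interval around `u x`; by convexity so does their
    -- mean.
    have hmem : ⨍ y, u y ∂ν ∈ Metric.closedBall (u x)
        (morreyConst K σ s p Q * (M * R₀ ^ (s - Q / p))) := by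
      refine (convex_closedBall _ _).average_mem Metric.isClosed_closedBall ?_ hint
      filter_upwards [hν] with y hy
      rw [Metric.mem_closedBall, Real.dist_eq]
      exact hosc y hy.1 hy.2 x hx.1 hx.2
    rw [Metric.mem_closedBall, Real.dist_eq, abs_sub_comm] at hmem
    exact hmem
  · filter_upwards [hν] with x hx using hv1 x hx.1 hx.2

end ChainData

/-! ### The three cases for a given ball and gradient -/

section Setting

variable {X : Type*} {ρ : X → X → ℝ} [MeasurableSpace X] {μ : Measure X} {s p σ Q R₀ b K : ℝ}
  {z₀ : X} {u : X → ℝ} {g : X → ℝ≥0∞}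

/-- The pointwise data attached to a gradient of finite norm, together with the averages of
`g ^ p` over `B₀` and `σ B₀`. -/
lemma exists_chainData_averages (hρ : IsQuasiMetric ρ) (hK : 1 ≤ K)
    (hKρ : ∀ x y, ρ y x ≤ K * ρ x y) (hs : 0 < s) (hp : 0 < p) (hσ : quasiConst ρ ≤ σ)
    (hσ1 : 1 ≤ σ) (hQ : 0 < Q) (hμ : IsQuasiMetricMeasure ρ μ) (hR : 0 < R₀) (hb : 0 < b)
    (hV : VCondition ρ μ z₀ R₀ σ Q b) (hg : IsGradient ρ μ (qball ρ z₀ (σ * R₀)) s u g)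
    (hG : lpNormOn μ (qball ρ z₀ (σ * R₀)) p g ≠ ∞) {M : ℝ}
    (hM : M = (lpNormOn μ (qball ρ z₀ (σ * R₀)) p g).toReal * b ^ (-(1 / p))) :
    ∃ (S : Set X) (h : X → ℝ), ChainData ρ K σ s (Q / p) M R₀ z₀ S u h ∧
      (∀ᵐ x ∂μ.restrict (qball ρ z₀ (σ * R₀)), x ∈ S) ∧
      (∀ᵐ x ∂μ.restrict (qball ρ z₀ R₀), x ∈ S ∧ ρ z₀ x < R₀) ∧
      (∀ x ∈ S, g x = ENNReal.ofReal (h x)) ∧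
      ⨍⁻ x in qball ρ z₀ (σ * R₀), g x ^ p ∂μ ≤ ENNReal.ofReal ((M * R₀ ^ (-(Q / p))) ^ p) ∧
      ⨍⁻ x in qball ρ z₀ R₀, g x ^ p ∂μ ≤ ENNReal.ofReal ((M * R₀ ^ (-(Q / p))) ^ p) := by
  obtain ⟨S, h, H, hS, hgS⟩ := exists_chainData hρ hK hKρ hs hp hσ hσ1 hQ hμ hR hb hV hg hG
  have hsub : qball ρ z₀ R₀ ⊆ qball ρ z₀ (σ * R₀) := qball_subset_qball_mul hσ1 hR
  have hV0 := hV z₀ R₀ hR (le_mul_of_one_le_left hR.le hσ1) hsub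
  rw [← hM] at H
  refine ⟨S, h, H, hS, ?_, hgS, ?_, ?_⟩
  · filter_upwards [ae_mono (Measure.restrict_mono hsub le_rfl) hS,
      ae_restrict_mem₀ (hμ.ball_measurable z₀ R₀ hR)] with x h1 h2 using ⟨h1, h2⟩
  · rw [hM]
    exact laverage_rpow_le hp hb Subset.rfl hR (hV0.trans (measure_mono hsub)) hG
  · rw [hM]
    exact laverage_rpow_le hp hb hsub hR hV0 hG

lemma gradientTerm_of_ne_top (hp : 0 < p) (hb : 0 < b) (hR : 0 < R₀) (hσ1 : 1 ≤ σ)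
    (hμ : IsQuasiMetricMeasure ρ μ) (hG : lpNormOn μ (qball ρ z₀ (σ * R₀)) p g ≠ ∞) :
    gradientTerm ρ μ z₀ R₀ σ Q b s p g = ENNReal.ofReal
      ((lpNormOn μ (qball ρ z₀ (σ * R₀)) p g).toReal * b ^ (-(1 / p)) * R₀ ^ (s - Q / p)) := by
  have hσR : 0 < σ * R₀ := by positivity
  rw [gradientTerm_eq hp hb hR (hμ.ball_pos z₀ _ hσR).ne' (hμ.ball_lt_top z₀ _ hσR).ne, mul_assoc,
    mul_comm (ENNReal.toReal _), ENNReal.ofReal_mul (q := ENNReal.toReal _) (by positivity),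
    ENNReal.ofReal_toReal hG]

lemma gradientTerm_of_eq_top (hp : 0 < p) (hb : 0 < b) (hR : 0 < R₀) (hσ1 : 1 ≤ σ)
    (hμ : IsQuasiMetricMeasure ρ μ) (hG : lpNormOn μ (qball ρ z₀ (σ * R₀)) p g = ∞) :
    gradientTerm ρ μ z₀ R₀ σ Q b s p g = ∞ := by
  have hσR : 0 < σ * R₀ := by positivity
  rw [gradientTerm_eq hp hb hR (hμ.ball_pos z₀ _ hσR).ne' (hμ.ball_lt_top z₀ _ hσR).ne, hG,
    ENNReal.mul_top]
  rw [Ne, ENNReal.ofReal_eq_zero, not_le]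
  positivity

lemma sobolev_subcritical (hρ : IsQuasiMetric ρ) (hK : 1 ≤ K)
    (hKρ : ∀ x y, ρ y x ≤ K * ρ x y) (hs : 0 < s) (hp : 0 < p) (hσ : quasiConst ρ ≤ σ)
    (hσ1 : 1 ≤ σ) (hQ : 0 < Q) (hpQ : p < Q / s) (hμ : IsQuasiMetricMeasure ρ μ) (hR : 0 < R₀)
    (hb : 0 < b) (hV : VCondition ρ μ z₀ R₀ σ Q b)
    (hu : MemHajlasz ρ μ (qball ρ z₀ (σ * R₀)) s p u)
    (hg : IsGradient ρ μ (qball ρ z₀ (σ * R₀)) s u g) :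
    MemLp u (ENNReal.ofReal (sobolevExp Q s p)) (μ.restrict (qball ρ z₀ R₀)) ∧
    (⨍⁻ x in qball ρ z₀ R₀, ENNReal.ofReal |u x| ^ sobolevExp Q s p ∂μ) ^
        (1 / sobolevExp Q s p) ≤
      ENNReal.ofReal (sobolevConst K σ s p Q) * gradientTerm ρ μ z₀ R₀ σ Q b s p g +
        ENNReal.ofReal (sobolevConst K σ s p Q) *
          (⨍⁻ x in qball ρ z₀ (σ * R₀), ENNReal.ofReal |u x| ^ p ∂μ) ^ (1 / p) ∧
    (⨅ γ : ℝ, (⨍⁻ x in qball ρ z₀ R₀, ENNReal.ofReal |u x - γ| ^ sobolevExp Q s p ∂μ) ^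
        (1 / sobolevExp Q s p)) ≤
      ENNReal.ofReal (sobolevConst K σ s p Q) * gradientTerm ρ μ z₀ R₀ σ Q b s p g := by
  have hsp : 0 < Q - s * p := by rw [lt_div_iff₀ hs] at hpQ; linarith
  have hq : 0 < sobolevExp Q s p := by unfold sobolevExp; positivity
  have hσR : 0 < σ * R₀ := by positivity
  have hsub : qball ρ z₀ R₀ ⊆ qball ρ z₀ (σ * R₀) := qball_subset_qball_mul hσ1 hR
  have : Fact (μ (qball ρ z₀ R₀) < ∞) := ⟨hμ.ball_lt_top _ _ hR⟩
  have : Fact (μ (qball ρ z₀ (σ * R₀)) < ∞) := ⟨hμ.ball_lt_top _ _ hσR⟩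
  have hC : 0 < sobolevConst K σ s p Q := by
    have := subcritConst_pos (s := s) (τ := Q / p) hK hσ1 (by rw [lt_div_iff₀ hp]; linarith)
    unfold sobolevConst; positivity
  have hC' : ENNReal.ofReal (sobolevConst K σ s p Q) ≠ 0 := by simpa using hC
  refine ⟨?_, ?_⟩
  -- The given gradient may have infinite norm, so integrability is derived from another gradient
  -- `g'` of finite norm; the displayed inequalities are then trivial when the norm of `g` is
  -- infinite.
  · obtain ⟨g', hg', hG'⟩ := hu.exists_gradient
    obtain ⟨S, h, H, -, hν, hgS, -, hav⟩ :=
      exists_chainData_averages hρ hK hKρ hs hp hσ hσ1 hQ hμ hR hb hV hg' hG' rfl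
    obtain ⟨γ, hγ⟩ := H.subcritical_oscillation hp hQ hpQ hν hgS hav
    exact memLp_of_laverage_lt_top (hu.aemeasurable.mono_measure (Measure.restrict_mono hsub le_rfl))
      γ hq (hγ.trans_lt (ENNReal.mul_lt_top ENNReal.ofReal_lt_top ENNReal.ofReal_lt_top))
  · by_cases hG : lpNormOn μ (qball ρ z₀ (σ * R₀)) p g = ∞
    · rw [gradientTerm_of_eq_top hp hb hR hσ1 hμ hG, ENNReal.mul_top hC']
      exact ⟨by rw [top_add]; exact le_top, le_top⟩
    · obtain ⟨S, h, H, hS, hν, hgS, hav', hav⟩ :=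
        exists_chainData_averages hρ hK hKρ hs hp hσ hσ1 hQ hμ hR hb hV hg hG rfl
      rw [gradientTerm_of_ne_top hp hb hR hσ1 hμ hG]
      refine ⟨H.subcritical_norm hp hQ hpQ hν hgS hav ?_ hS hav' hg.aemeasurable hu.aemeasurable, ?_⟩
      · rw [Ne, Measure.restrict_eq_zero]; exact (hμ.ball_pos _ _ hσR).ne'
      · obtain ⟨γ, hγ⟩ := H.subcritical_oscillation hp hQ hpQ hν hgS hav
        exact iInf_le_of_le γ hγ

lemma exponential_critical (hρ : IsQuasiMetric ρ) (hK : 1 ≤ K)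
    (hKρ : ∀ x y, ρ y x ≤ K * ρ x y) (hs : 0 < s) (hp : 0 < p) (hσ : quasiConst ρ ≤ σ)
    (hσ1 : 1 ≤ σ) (hQ : 0 < Q) (hpQ : p = Q / s) (hμ : IsQuasiMetricMeasure ρ μ) (hR : 0 < R₀)
    (hb : 0 < b) (hV : VCondition ρ μ z₀ R₀ σ Q b)
    (hu : MemHajlasz ρ μ (qball ρ z₀ (σ * R₀)) s p u)
    (hg : IsGradient ρ μ (qball ρ z₀ (σ * R₀)) s u g)
    (hG0 : 0 < lpNormOn μ (qball ρ z₀ (σ * R₀)) p g) :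
    IntegrableOn u (qball ρ z₀ R₀) μ ∧
    ⨍⁻ x in qball ρ z₀ R₀, ENNReal.ofReal (Real.exp (expRate K σ s p Q * b ^ (s / Q) *
      (|u x - ⨍ y in qball ρ z₀ R₀, u y ∂μ| /
        (lpNormOn μ (qball ρ z₀ (σ * R₀)) p g).toReal))) ∂μ ≤
      ENNReal.ofReal (expAverageBound K σ s p Q) := by
  have hsQ : s = Q / p := by rw [hpQ]; field_simp
  have hσR : 0 < σ * R₀ := by positivity
  have hsub : qball ρ z₀ R₀ ⊆ qball ρ z₀ (σ * R₀) := qball_subset_qball_mul hσ1 hR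
  have : Fact (μ (qball ρ z₀ R₀) < ∞) := ⟨hμ.ball_lt_top _ _ hR⟩
  have : NeZero (μ.restrict (qball ρ z₀ R₀)) :=
    ⟨by rw [Ne, Measure.restrict_eq_zero]; exact (hμ.ball_pos _ _ hR).ne'⟩
  have hum := hu.aemeasurable.mono_measure (Measure.restrict_mono hsub le_rfl)
  refine ⟨?_, ?_⟩
  · obtain ⟨g', hg', hG'⟩ := hu.exists_gradient
    obtain ⟨S, h, H, -, hν, hgS, -, hav⟩ :=
      exists_chainData_averages hρ hK hKρ hs hp hσ hσ1 hQ hμ hR hb hV hg' hG' rfl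
    -- The auxiliary gradient `g'` may have norm zero even though `g` does not.
    rcases H.pos_or with hM | h0
    · exact (H.critical_laverage hp hQ hsQ hM hν hum hgS hav).1
    · exact H.integrable_of_forall_eq_zero h0 (hν.mono fun _ hx => hx.1)
  · by_cases hG : lpNormOn μ (qball ρ z₀ (σ * R₀)) p g = ∞
    -- Here `∞.toReal = 0` and division by zero is zero, so the integrand is `1`; the summand `1` in
    -- `expAverageBound` accommodates this.
    · simp only [hG, ENNReal.toReal_top, div_zero, mul_zero, Real.exp_zero, ENNReal.ofReal_one]
      rw [laverage_const, ← ENNReal.ofReal_one]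
      refine ENNReal.ofReal_le_ofReal ?_
      have := expBound_pos (K := K) (σ := σ) (s := s) (p := p) (Q := Q)
      unfold expAverageBound
      have : 0 ≤ expBound K σ s p Q * 2 * Real.exp (expBound K σ s p Q * 2) := by positivity
      linarith
    · obtain ⟨S, h, H, -, hν, hgS, -, hav⟩ :=
        exists_chainData_averages hρ hK hKρ hs hp hσ hσ1 hQ hμ hR hb hV hg hG rfl
      have hGr : 0 < (lpNormOn μ (qball ρ z₀ (σ * R₀)) p g).toReal := ENNReal.toReal_pos hG0.ne' hG
      refine le_of_eq_of_le ?_ (H.critical_laverage hp hQ hsQ (by positivity) hν hum hgS hav).2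
      congr 1
      ext x
      rw [show s / Q = 1 / p by rw [hpQ]; field_simp, Real.rpow_neg hb.le]
      congr 2
      field_simp

lemma holder_supercritical (hρ : IsQuasiMetric ρ) (hK : 1 ≤ K)
    (hKρ : ∀ x y, ρ y x ≤ K * ρ x y) (hs : 0 < s) (hp : 0 < p) (hσ : quasiConst ρ ≤ σ)
    (hσ1 : 1 ≤ σ) (hQ : 0 < Q) (hpQ : Q / s < p) (hμ : IsQuasiMetricMeasure ρ μ) (hR : 0 < R₀)
    (hb : 0 < b) (hV : VCondition ρ μ z₀ R₀ σ Q b)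
    (hu : MemHajlasz ρ μ (qball ρ z₀ (σ * R₀)) s p u)
    (hg : IsGradient ρ μ (qball ρ z₀ (σ * R₀)) s u g) {C : ℝ} (hC : 0 < C)
    (hCm : morreyConst K σ s p Q ≤ C) (hCh : holderConst K σ s (Q / p) ≤ C) :
    IntegrableOn u (qball ρ z₀ R₀) μ ∧
    eLpNorm (fun x => u x - ⨍ y in qball ρ z₀ R₀, u y ∂μ) ∞ (μ.restrict (qball ρ z₀ R₀)) ≤
      ENNReal.ofReal C * gradientTerm ρ μ z₀ R₀ σ Q b s p g ∧
    ∃ v : X → ℝ, v =ᵐ[μ.restrict (qball ρ z₀ R₀)] u ∧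
      IsHolderOn ρ (qball ρ z₀ R₀) (s - Q / p) v ∧
      ∀ x ∈ qball ρ z₀ R₀, ∀ y ∈ qball ρ z₀ R₀, ENNReal.ofReal |v x - v y| ≤
        ENNReal.ofReal (C * b ^ (-(1 / p)) * ρ x y ^ (s - Q / p)) *
          lpNormOn μ (qball ρ z₀ (σ * R₀)) p g := by
  have hsQ : Q / p < s := by rw [div_lt_iff₀ hs] at hpQ; rw [div_lt_iff₀ hp]; linarith
  have hσR : 0 < σ * R₀ := by positivity
  have hsub : qball ρ z₀ R₀ ⊆ qball ρ z₀ (σ * R₀) := qball_subset_qball_mul hσ1 hR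
  have : Fact (μ (qball ρ z₀ R₀) < ∞) := ⟨hμ.ball_lt_top _ _ hR⟩
  have : NeZero (μ.restrict (qball ρ z₀ R₀)) :=
    ⟨by rw [Ne, Measure.restrict_eq_zero]; exact (hμ.ball_pos _ _ hR).ne'⟩
  have hum := hu.aemeasurable.mono_measure (Measure.restrict_mono hsub le_rfl)
  have hholder : ∀ {M : ℝ} {v : X → ℝ}, (∀ x, ρ z₀ x < R₀ → ∀ y, ρ z₀ y < R₀ →
      |v x - v y| ≤ holderConst K σ s (Q / p) * (M * ρ x y ^ (s - Q / p))) →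
      IsHolderOn ρ (qball ρ z₀ R₀) (s - Q / p) v := fun {M v} hv =>
    ⟨holderConst K σ s (Q / p) * M, fun x hx y hy => by rw [mul_assoc]; exact hv x hx y hy⟩
  by_cases hG : lpNormOn μ (qball ρ z₀ (σ * R₀)) p g = ∞
  · obtain ⟨g', hg', hG'⟩ := hu.exists_gradient
    obtain ⟨S, h, H, -, hν, -⟩ :=
      exists_chainData_averages hρ hK hKρ hs hp hσ hσ1 hQ hμ hR hb hV hg' hG' rfl
    obtain ⟨hint, -, v, hv, hv'⟩ := H.supercritical_eLpNorm hsQ hν hum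
    rw [gradientTerm_of_eq_top hp hb hR hσ1 hμ hG, ENNReal.mul_top (by simpa using hC)]
    refine ⟨hint, le_top, v, hv, hholder hv', fun x _ y _ => ?_⟩
    -- On the diagonal the right side is `0 * ∞ = 0`, so that case is separate; off the diagonal the
    -- right side is infinite.
    by_cases hxy : x = y
    · simp [hxy]
    · have hpos := H.pos_of_ne x y hxy
      rw [hG, ENNReal.mul_top]
      · exact le_top
      · rw [Ne, ENNReal.ofReal_eq_zero, not_le]; positivity
  · obtain ⟨S, h, H, -, hν, -⟩ :=
      exists_chainData_averages hρ hK hKρ hs hp hσ hσ1 hQ hμ hR hb hV hg hG rfl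
    obtain ⟨hint, hsup, v, hv, hv'⟩ := H.supercritical_eLpNorm hsQ hν hum
    refine ⟨hint, ?_, v, hv, hholder hv', fun x hx y hy => ?_⟩
    · rw [gradientTerm_of_ne_top hp hb hR hσ1 hμ hG, ← ENNReal.ofReal_mul hC.le]
      refine hsup.trans (ENNReal.ofReal_le_ofReal ?_)
      gcongr
    · have := hρ.nonneg x y
      rw [← ENNReal.ofReal_toReal hG, ← ENNReal.ofReal_mul (by positivity)]
      refine ENNReal.ofReal_le_ofReal ((hv' x hx y hy).trans ?_)
      calc _ ≤ C * ((lpNormOn μ (qball ρ z₀ (σ * R₀)) p g).toReal * b ^ (-(1 / p)) *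
            ρ x y ^ (s - Q / p)) := by gcongr
        _ = _ := by ring

end Setting

end HajlaszEmbedding

end

/-! ### Choice of the constants -/

theorem mainTheorem5 {X : Type*} [Nontrivial X] (ρ : X → X → ℝ)
    (hρ : HajlaszEmbedding.IsQuasiMetric ρ)
    (s p σ Q : ℝ) (hs : 0 < s) (hp : 0 < p) (hσ : HajlaszEmbedding.quasiConst ρ ≤ σ) (hQ : 0 < Q) :
    ∃ C C₁ C₂ : ℝ, 0 < C ∧ 0 < C₁ ∧ 0 < C₂ ∧
      ∀ [MeasurableSpace X] (μ : Measure X), HajlaszEmbedding.IsQuasiMetricMeasure ρ μ →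
      ∀ (z₀ : X) (R₀ b : ℝ), 0 < R₀ → 0 < b → HajlaszEmbedding.VCondition ρ μ z₀ R₀ σ Q b →
      ∀ B₀ σB₀ : Set X, B₀ = HajlaszEmbedding.qball ρ z₀ R₀ →
        σB₀ = HajlaszEmbedding.qball ρ z₀ (σ * R₀) →
      ∀ (u : X → ℝ) (g : X → ℝ≥0∞), HajlaszEmbedding.MemHajlasz ρ μ σB₀ s p u →
        HajlaszEmbedding.IsGradient ρ μ σB₀ s u g →
        -- (a) the case `p < Q / s`
        (p < Q / s →
          MemLp u (ENNReal.ofReal (HajlaszEmbedding.sobolevExp Q s p)) (μ.restrict B₀) ∧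
          (⨍⁻ x in B₀, ENNReal.ofReal |u x| ^ HajlaszEmbedding.sobolevExp Q s p ∂μ) ^
                (1 / HajlaszEmbedding.sobolevExp Q s p) ≤
            ENNReal.ofReal C * HajlaszEmbedding.gradientTerm ρ μ z₀ R₀ σ Q b s p g +
              ENNReal.ofReal C * (⨍⁻ x in σB₀, ENNReal.ofReal |u x| ^ p ∂μ) ^ (1 / p) ∧
          (⨅ γ : ℝ, (⨍⁻ x in B₀, ENNReal.ofReal |u x - γ| ^
                HajlaszEmbedding.sobolevExp Q s p ∂μ) ^ (1 / HajlaszEmbedding.sobolevExp Q s p)) ≤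
            ENNReal.ofReal C * HajlaszEmbedding.gradientTerm ρ μ z₀ R₀ σ Q b s p g) ∧
        -- (b) the case `p = Q / s`; if the norm of `g` is infinite, the quotient is `0`
        (p = Q / s → 0 < HajlaszEmbedding.lpNormOn μ σB₀ (Q / s) g →
          IntegrableOn u B₀ μ ∧
          ⨍⁻ x in B₀, ENNReal.ofReal (Real.exp (C₁ * b ^ (s / Q) * (|u x - ⨍ y in B₀, u y ∂μ| /
              (HajlaszEmbedding.lpNormOn μ σB₀ (Q / s) g).toReal))) ∂μ ≤ ENNReal.ofReal C₂) ∧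
        -- (c) the case `p > Q / s`
        (Q / s < p →
          IntegrableOn u B₀ μ ∧
          eLpNorm (fun x => u x - ⨍ y in B₀, u y ∂μ) ∞ (μ.restrict B₀) ≤
            ENNReal.ofReal C * HajlaszEmbedding.gradientTerm ρ μ z₀ R₀ σ Q b s p g ∧
          ∃ v : X → ℝ, v =ᵐ[μ.restrict B₀] u ∧
            HajlaszEmbedding.IsHolderOn ρ B₀ (s - Q / p) v ∧
            ∀ x ∈ B₀, ∀ y ∈ B₀, ENNReal.ofReal |v x - v y| ≤
              ENNReal.ofReal (C * b ^ (-(1 / p)) * ρ x y ^ (s - Q / p)) *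
                HajlaszEmbedding.lpNormOn μ σB₀ p g) := by
  obtain ⟨K, hK, hKρ⟩ := hρ.exists_symm
  have hσ1 := hρ.one_le_of_quasiConst_le hσ
  -- The parameters `s`, `p`, `Q` are fixed before the constants, so only one regime occurs and the
  -- constants it does not use are set to `1`. All are built from `K`, `σ`, `s`, `p`, `Q`, before
  -- the measure is introduced.
  rcases lt_trichotomy p (Q / s) with hpQ | hpQ | hpQ
  · have hC : 0 < HajlaszEmbedding.sobolevConst K σ s p Q := by
      have hsp : s < Q / p := by rw [lt_div_iff₀ hs] at hpQ; rw [lt_div_iff₀ hp]; linarith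
      have := HajlaszEmbedding.subcritConst_pos hK hσ1 hsp
      unfold HajlaszEmbedding.sobolevConst; positivity
    refine ⟨_, 1, 1, hC, one_pos, one_pos, ?_⟩
    rintro _ μ hμ z₀ R₀ b hR hb hV _ _ rfl rfl u g hu hg
    exact ⟨fun _ => HajlaszEmbedding.sobolev_subcritical hρ hK hKρ hs hp hσ hσ1 hQ hpQ hμ hR hb hV
      hu hg, fun h => absurd h hpQ.ne, fun h => absurd h hpQ.not_gt⟩
  · have hC₂ : 0 < HajlaszEmbedding.expAverageBound K σ s p Q := by
      have := HajlaszEmbedding.expBound_pos (K := K) (σ := σ) (s := s) (p := p) (Q := Q)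
      unfold HajlaszEmbedding.expAverageBound; positivity
    refine ⟨1, _, _, one_pos, HajlaszEmbedding.expRate_pos (s := s) hK hσ1 hp hQ, hC₂, ?_⟩
    rintro _ μ hμ z₀ R₀ b hR hb hV _ _ rfl rfl u g hu hg
    refine ⟨fun h => absurd hpQ h.ne, fun _ hG => ?_, fun h => absurd hpQ h.ne'⟩
    rw [← hpQ] at hG ⊢
    exact HajlaszEmbedding.exponential_critical hρ hK hKρ hs hp hσ hσ1 hQ hpQ hμ hR hb hV hu hg hG
  · refine ⟨max 1 (max (HajlaszEmbedding.morreyConst K σ s p Q)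
      (HajlaszEmbedding.holderConst K σ s (Q / p))), 1, 1, by positivity, one_pos, one_pos, ?_⟩
    rintro _ μ hμ z₀ R₀ b hR hb hV _ _ rfl rfl u g hu hg
    exact ⟨fun h => absurd h hpQ.not_gt, fun h => absurd h hpQ.ne', fun _ =>
      HajlaszEmbedding.holder_supercritical hρ hK hKρ hs hp hσ hσ1 hQ hpQ hμ hR hb hV hu hg
        (by positivity) ((le_max_left _ _).trans (le_max_right _ _))
        ((le_max_right _ _).trans (le_max_right _ _))⟩
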